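/- **Setting.** An $n$-player Bayesian game $\Gamma$ has finite type sets $\mathcal T_i$, finite nonempty action sets $A_i$, a commonly known distribution $\Pr$ on type profiles and utilities $u_i(t,a)$. In the extension $\Gamma_d$ by a mediator $d$, play proceeds in stages: in each stage every player sends $d$ a message (a finite bit string, possibly empty), $d$ then sends every player a message that depends on all inputs received so far and on $d$'s coin flips, and every player then chooses an action of $\Gamma$ or no action. Only a player's first action counts, and a player who never acts plays a default action $a_i^*$. A strategy is a function of the player's type, message history and private independent fair coin flips. In the cheap-talk extension $\Gamma_{\mathrm{CT}}$ the mediator just forwards the players' messages to each other (over point-to-point channels, with or without an additional broadcast channel). $\Gamma'+CT(K)$ is $\Gamma'$ with additional private channels among the players in $K$. Write $u_i(t_S,\Gamma',\sigma)$ for $i$'s expected utility under $\sigma$ in $\Gamma'$, conditional on the players in $S$ having types $t_S$; only types of positive probability are considered. A profile $\sigma$ in $\Gamma'$ is *$t$-immune* if $u_i(t_i,\Gamma'+CT(T),\sigma_{-T},\tau_T)\ge u_i(t_i,\Gamma',\sigma)$ for all $T$ with $|T|\le t$, all $\tau$, all $i\notin T$ and all $t_i$. It is *$(k,t)$-robust*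 if it is $t$-immune and for all disjoint $K,T$ with $1\le|K|\le k$, $|T|\le t$, and all $t_{K\cup T}$, there is no $\tau$ such that $$u_i(t_{K\cup T},\Gamma'+CT(K\cup T),\tau_{K\cup T},\sigma_{-(K\cup T)})>u_i(t_i,\Gamma'+CT(T),\tau_T,\sigma_{-T})$$ for all $i\in K$; it is *strongly $(k,t)$-robust* if there is no $\tau$ for which this holds for even one $i\in K$. A profile $\rho$ in $\Gamma$ is an *$m$-punishment strategy with respect to $\sigma$* in $\Gamma_d$ if $u_i(t_K,\Gamma_d,\sigma)>u_i(t_K,\Gamma+CT(K),\phi_K,\rho_{-K})$ for all $K$ with $|K|\le m$, all $\phi$, all $t_K$ and all $i\in K$. The *running time* of a play is the number of stages until the last player has acted ($\infty$ if some player never acts). A profile $\sigma'$ in $\Gamma_{\mathrm{CT}}$ is a *$(k,t)$-robust implementation* of $\sigma$ if $\sigma'$ is $(k,t)$-robust in $\Gamma_{\mathrm{CT}}$ and, for each type profile of positive probability, $\sigma'$ and $\sigma$ induce the same distribution over action profiles. **Theorem.** Let $n,k,t$ be natural numbers with $2k+3t<n\le 3k+3t$. There are an $n$-player Bayesian game $\Gamma$,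 a mediator $d$, a strategy profile $\sigma$ in $\Gamma_d$ and a strategy profile $\rho$ in $\Gamma$ such that, for every choice of default actions, $\sigma$ is a strong $(k,t)$-robust equilibrium of $\Gamma_d$, $\rho$ is a $(k+t)$-punishment strategy with respect to $\sigma$, and, whether or not $\Gamma_{\mathrm{CT}}$ has broadcast, there do not exist a natural number $c$ and a strategy profile $\sigma_{\mathrm{CT}}$ in $\Gamma_{\mathrm{CT}}$ such that the running time of $\sigma_{\mathrm{CT}}$ on the equilibrium path (if all players follow $\sigma_{\mathrm{CT}}$, with probability 1, for every type profile of positive probability) is at most $c$ and $\sigma_{\mathrm{CT}}$ is a $(k,t)$-robust implementation of $\sigma$. -/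

import Mathlib

open MeasureTheory

namespace MediatorGames

/-- Messages are finite bit strings; the empty string is the empty message (no message at all). -/
abbrev Msg : Type := List Bool

/-- An infinite sequence of coin flips. -/
abbrev Coins : Type := ℕ → Bool

/-- The law of a sequence of independent unbiased coin flips. -/
noncomputable def coinMeasure : Measure Coins :=
  Measure.infinitePi fun _ : ℕ => (PMF.uniformOfFintype Bool).toMeasure

/-- The randomness of a play: a private coin sequence for each of the `n` players, and one for
the mediator. -/
abbrev Rand (n : ℕ) : Type := (Fin n → Coins) × Coins

/-- All coin sequences are independent. -/
noncomputable def randMeasure (n : ℕ) : Measure (Rand n) :=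
  (Measure.pi fun _ : Fin n => coinMeasure).prod coinMeasure

/-- A (finite, normal-form) Bayesian game with player set `Fin n`. -/
structure BayesianGame (n : ℕ) where
  /-- the types of each player -/
  Ty : Fin n → Type
  /-- the actions of each player -/
  Act : Fin n → Type
  [fintypeTy : ∀ i, Fintype (Ty i)]
  [fintypeAct : ∀ i, Fintype (Act i)]
  [nonemptyAct : ∀ i, Nonempty (Act i)]
  /-- the commonly known distribution of the type profile -/
  prior : PMF (∀ i, Ty i)
  /-- the utility of each player, given the type profile and the action profile -/
  u : Fin n → (∀ i, Ty i) → (∀ i, Act i) → ℝ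

attribute [instance] BayesianGame.fintypeTy BayesianGame.fintypeAct BayesianGame.nonemptyAct

/-- A mediator in the general sense, for `n` players: it receives elements of `In` and returns
elements of `Out`. The output to each player in a stage is a function of all inputs received up to
and including that stage (a chronological list of input vectors) and of the mediator's coins. -/
structure Medium (n : ℕ) (In Out : Type) where
  out : List (Fin n → In) → Coins → Fin n → Out
  meas : ∀ h i o, MeasurableSet {w | out h w i = o}

/-- A mediator exchanges messages with the players. -/
abbrev Mediator (n : ℕ) : Type := Medium n Msg Msg

/-- No communication at all. -/
def noTalk (n : ℕ) : Medium n Unit Unit where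
  out _ _ _ := ()
  meas _ _ _ := MeasurableSet.const _

/-- In a stage of cheap talk, a player sends a private message to each player and one message to
be broadcast. -/
abbrev TalkIn (n : ℕ) : Type := (Fin n → Msg) × Msg

/-- In a stage of cheap talk, a player receives from each player a private message and a
broadcast message. -/
abbrev TalkOut (n : ℕ) : Type := Fin n → Msg × Msg

/-- Cheap talk: the mediator forwards the messages of the current stage to the intended
recipients. Broadcast messages are forwarded only if `broadcast` is `true`; otherwise there are
only point-to-point channels. -/
def cheapTalk (n : ℕ) (broadcast : Bool) : Medium n (TalkIn n) (TalkOut n) where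
  out h _ i j :=
    match h.getLast? with
    | none => ([], [])
    | some x => ((x j).1 i, if broadcast = true then (x j).2 else [])
  meas _ _ _ := MeasurableSet.const _

/-- `d.withCT K` is `d` together with private cheap-talk channels among the players in `K`. Other
players get nothing from, and deliver nothing to, these channels. -/
def Medium.withCT {n : ℕ} {In Out : Type} (d : Medium n In Out) (K : Finset (Fin n)) :
    Medium n (In × (Fin n → Msg)) (Out × (Fin n → Msg)) where
  out h w i :=
    (d.out (h.map fun x j => (x j).1) w i, fun j =>
      match h.getLast? with
      | none => []
      | some x => if i ∈ K ∧ j ∈ K then (x j).2 i else [])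
  meas h i o := by
    simp only [Prod.ext_iff, Set.ofPred_and]
    exact (d.meas _ _ _).inter (MeasurableSet.const _)

namespace BayesianGame

variable {n : ℕ} (Γ : BayesianGame n) {In Out : Type}

abbrev TypeProfile : Type := ∀ i, Γ.Ty i

abbrev ActProfile : Type := ∀ i, Γ.Act i

/-- A (behavior) strategy of player `i` in an extension of `Γ` by communication. The player
knows the type, the chronological list of what was received in the stages so far, and the private
coins (which together determine what the player has sent). `send` is the input to the mediator in
the first phase of a stage; `act` is the action of `Γ`, or no action, chosen in the third phase,
when the output of the current stage has been received. -/
structure Strategy (i : Fin n) (In Out : Type) where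
  send : Γ.Ty i → List Out → Coins → In
  act : Γ.Ty i → List Out → Coins → Option (Γ.Act i)
  meas_send : ∀ t h x, MeasurableSet {w | send t h w = x}
  meas_act : ∀ t h x, MeasurableSet {w | act t h w = x}

/-- A strategy profile in an extension of `Γ`. -/
abbrev Profile (In Out : Type) : Type := ∀ i, Γ.Strategy i In Out

/-- A (behavior) strategy of player `i` in the underlying game `Γ`. -/
structure BaseStrategy (i : Fin n) where
  act : Γ.Ty i → Coins → Γ.Act i
  meas_act : ∀ t x, MeasurableSet {w | act t w = x}

/-- A strategy profile in the underlying game `Γ`. -/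
abbrev BaseProfile : Type := ∀ i, Γ.BaseStrategy i

variable {Γ}

/-- A strategy in the underlying game, with the action taken in the first stage. -/
def BaseStrategy.toStrategy {i : Fin n} (s : Γ.BaseStrategy i) : Γ.Strategy i Unit Unit where
  send _ _ _ := ()
  act t _ w := some (s.act t w)
  meas_send _ _ _ := MeasurableSet.const _
  meas_act t _ x := by
    cases x with
    | none => simp
    | some a => simpa using s.meas_act t a

/-- A strategy in a game, used in the same game with additional cheap-talk channels, which the
player ignores. -/
def Strategy.lift {i : Fin n} (s : Γ.Strategy i In Out) :
    Γ.Strategy i (In × (Fin n → Msg)) (Out × (Fin n → Msg)) where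
  send t h w := (s.send t (h.map Prod.fst) w, fun _ => [])
  act t h w := s.act t (h.map Prod.fst) w
  meas_send t h x := by
    simp only [Prod.ext_iff, Set.ofPred_and]
    exact (s.meas_send _ _ _).inter (MeasurableSet.const _)
  meas_act t h x := s.meas_act _ _ _

/-- The profile `(τ_K, σ_{-K})` in the game with additional cheap-talk channels. -/
def deviate (K : Finset (Fin n)) (τ : Γ.Profile (In × (Fin n → Msg)) (Out × (Fin n → Msg)))
    (σ : Γ.Profile In Out) : Γ.Profile (In × (Fin n → Msg)) (Out × (Fin n → Msg)) :=
  fun i => if i ∈ K then τ i else (σ i).lift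

variable (d : Medium n In Out) (σ : Γ.Profile In Out)

/-- The first `r` stages of a play: all inputs sent to the mediator, and what each player has
received. -/
def history (t : Γ.TypeProfile) (w : Rand n) : ℕ → List (Fin n → In) × (Fin n → List Out)
  | 0 => ([], fun _ => [])
  | r + 1 =>
    let past := history t w r
    let ins := past.1 ++ [fun i => (σ i).send (t i) (past.2 i) (w.1 i)]
    (ins, fun i => past.2 i ++ [d.out ins w.2 i])

/-- The choice of player `i` in the third phase of stage `r + 1`. -/
def move (t : Γ.TypeProfile) (w : Rand n) (r : ℕ) (i : Fin n) : Option (Γ.Act i) :=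
  (σ i).act (t i) ((history d σ t w (r + 1)).2 i) (w.1 i)

open Classical in
/-- The action profile that results from a play. Only the first action chosen by a player counts;
a player `i` who never chooses an action plays the default action `dflt i`. -/
noncomputable def outcome (dflt : Γ.ActProfile) (t : Γ.TypeProfile) (w : Rand n) :
    Γ.ActProfile :=
  fun i =>
    if h : ∃ r, (move d σ t w r i).isSome = true then
      (move d σ t w (Nat.find h) i).get (Nat.find_spec h)
    else dflt i

/-- The number of stages until the last player has made a move in the underlying game; infinite
if some player never does. -/
noncomputable def runningTime (t : Γ.TypeProfile) (w : Rand n) : ℕ∞ :=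
  ⨆ i : Fin n, ⨅ (r : ℕ) (_ : (move d σ t w r i).isSome = true), ((r + 1 : ℕ) : ℕ∞)

/-- If all players follow `σ`, the running time is at most `c` (with probability 1, for all type
profiles that can occur). -/
def RunningTimeAtMost (c : ℕ) : Prop :=
  ∀ t ∈ Γ.prior.support, ∀ᵐ w ∂(randMeasure n), runningTime d σ t w ≤ (c : ℕ∞)

/-- The probability of the action profile `a` if the type profile is `t`. -/
noncomputable def actProb (dflt : Γ.ActProfile) (t : Γ.TypeProfile) (a : Γ.ActProfile) : ℝ :=
  (randMeasure n).real {w | outcome d σ dflt t w = a}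

/-- The expected utility of player `i` if the type profile is `t`. -/
noncomputable def utility (dflt : Γ.ActProfile) (i : Fin n) (t : Γ.TypeProfile) : ℝ :=
  ∑ a : Γ.ActProfile, actProb d σ dflt t a * Γ.u i t a

variable (Γ) in
open Classical in
/-- The type profiles in which the players in `S` have the same types as in `t`. -/
noncomputable def agreeing (S : Finset (Fin n)) (t : Γ.TypeProfile) : Finset Γ.TypeProfile :=
  Finset.univ.filter fun t' => ∀ i ∈ S, t' i = t i

variable (Γ) in
/-- The probability that the players in `S` have the types that they have in `t`. -/
noncomputable def typeProb (S : Finset (Fin n)) (t : Γ.TypeProfile) : ℝ :=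
  ∑ t' ∈ Γ.agreeing S t, (Γ.prior t').toReal

/-- The expected utility of player `i`, conditional on the players in `S` having the types that
they have in `t`. -/
noncomputable def condUtility (dflt : Γ.ActProfile) (S : Finset (Fin n)) (t : Γ.TypeProfile)
    (i : Fin n) : ℝ :=
  ∑ t' ∈ Γ.agreeing S t, (Γ.prior t').toReal / Γ.typeProb S t * utility d σ dflt i t'

/-- `σ` is `m`-immune: no set `T` of at most `m` players can give another player a worse payoff
than the payoff from `σ`. -/
def IsImmune (dflt : Γ.ActProfile) (m : ℕ) : Prop :=
  ∀ T : Finset (Fin n), T.card ≤ m →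
  ∀ τ : Γ.Profile (In × (Fin n → Msg)) (Out × (Fin n → Msg)),
  ∀ i ∉ T, ∀ t : Γ.TypeProfile, 0 < Γ.typeProb {i} t →
    condUtility d σ dflt {i} t i ≤ condUtility (d.withCT T) (deviate T τ σ) dflt {i} t i

/-- Player `i` gains if the players in `K` join those in `T` in deviating according to `τ`, given
the types that the players in `K ∪ T` have in `t`. -/
def Gains (dflt : Γ.ActProfile) (K T : Finset (Fin n))
    (τ : Γ.Profile (In × (Fin n → Msg)) (Out × (Fin n → Msg))) (t : Γ.TypeProfile)
    (i : Fin n) : Prop :=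
  condUtility (d.withCT T) (deviate T τ σ) dflt {i} t i <
    condUtility (d.withCT (K ∪ T)) (deviate (K ∪ T) τ σ) dflt (K ∪ T) t i

/-- `σ` is a `(k, m)`-robust equilibrium: it is `m`-immune, and no (nonempty) coalition `K` of at
most `k` players has a deviation from which all members gain, even with the help of a set `T` of
at most `m` players. -/
def IsRobust (dflt : Γ.ActProfile) (k m : ℕ) : Prop :=
  IsImmune d σ dflt m ∧
  ∀ K T : Finset (Fin n), K.Nonempty → K.card ≤ k → T.card ≤ m → Disjoint K T →
  ∀ t : Γ.TypeProfile, 0 < Γ.typeProb (K ∪ T) t →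
    ¬ ∃ τ : Γ.Profile (In × (Fin n → Msg)) (Out × (Fin n → Msg)),
      ∀ i ∈ K, Gains d σ dflt K T τ t i

/-- `σ` is a strong `(k, m)`-robust equilibrium: as for a `(k, m)`-robust equilibrium, but there
is no deviation from which even one member of `K` gains. -/
def IsStrongRobust (dflt : Γ.ActProfile) (k m : ℕ) : Prop :=
  IsImmune d σ dflt m ∧
  ∀ K T : Finset (Fin n), K.card ≤ k → T.card ≤ m → Disjoint K T →
  ∀ t : Γ.TypeProfile, 0 < Γ.typeProb (K ∪ T) t →
    ¬ ∃ τ : Γ.Profile (In × (Fin n → Msg)) (Out × (Fin n → Msg)),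
      ∃ i ∈ K, Gains d σ dflt K T τ t i

/-- `ρ` is an `m`-punishment strategy with respect to `σ`: if all players but a set `K` of at most
`m` use `ρ` in the underlying game, then the players in `K`, who may talk to each other, are worse
off than with `σ`, whatever they do. -/
def IsPunishment (dflt : Γ.ActProfile) (m : ℕ) (ρ : Γ.BaseProfile) : Prop :=
  ∀ K : Finset (Fin n), K.card ≤ m →
  ∀ φ : Γ.Profile (Unit × (Fin n → Msg)) (Unit × (Fin n → Msg)),
  ∀ t : Γ.TypeProfile, 0 < Γ.typeProb K t → ∀ i ∈ K,
    condUtility ((noTalk n).withCT K) (deviate K φ fun j => (ρ j).toStrategy) dflt K t i <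
      condUtility d σ dflt K t i

/-- Two strategy profiles in extensions of `Γ` induce the same function from (possible) type
profiles to distributions over action profiles. -/
def Implements {In' Out' : Type} (d' : Medium n In' Out') (σ' : Γ.Profile In' Out')
    (dflt : Γ.ActProfile) : Prop :=
  ∀ t ∈ Γ.prior.support, ∀ a : Γ.ActProfile, actProb d' σ' dflt t a = actProb d σ dflt t a

end BayesianGame

end MediatorGames

open MediatorGames

/-! Write `m` for the bound `t` on malicious players. The game is secret sharing plus a temptation
to mislead. For each set `A` of `k + m` players, an independent random bit is known exactly to the
players outside `A`, and the secret is the sum of these bits. Hence `k + m` players together know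
nothing about it: they miss the bit of a set that contains them. A correct guess pays `n + 1`. A
player gets a bonus of `1` if the wrong guesses and the flagged right guesses of the others, with at
most `k - 1` flags counted, number at least `k + m`.

With the mediator: share vectors with different secrets differ in at least `n - (k + m)` entries. As
`2k + 3m < n`, decoding with tolerance `m` corrects `m` lies, and `k + m` lies can silence the
mediator but not make it announce a wrong secret. If it speaks, the outsiders guess right without
flags, so a coalition member sees at most `k + m - 1` wrong or flagged others and gets no bonus. If
it is silent, the coalition knows nothing and the loss of half the main reward outweighs any bonus
(`guessUtility_add_flip_le`). Constant guesses punish for the same reason.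

With cheap talk: as `n ≤ 3k + 3m`, the players split into three groups of at most `k + m`, two of
exactly that size. Call a group ambiguous after stage `r` if, with positive probability, its joint
information does not determine the secret. After the time bound none is ambiguous, because its
members have acted correctly. If none is ambiguous after stage `r + 1`, then none is after stage `r`
(`not_ambiguous_of_succ`). Otherwise some group `X` cannot tell two situations apart, and from then
on either other group can pretend to be in the opposite situation. `X` sees the same in both plays
and so guesses wrong in one of them. Yet the pretenders still learn the secret one stage later,
since the messages of that stage were determined before the pretence could influence the outsiders.
They therefore collect the bonus, against robustness (`card_fooled_lt`). Descending to stage `0`,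
where every such group is ambiguous, gives the contradiction. Robustness compares gains with the
payoff under the deviation of `T` alone; `condUtility_le_of_isImmune` bounds that payoff. -/

namespace MediatorGames

/-! ### Measurability of functions with countably many values -/

section DiscMeas

variable {Ω Ω' β γ : Type*} [MeasurableSpace Ω] [MeasurableSpace Ω']

/-- A function all of whose level sets are measurable. -/
def DiscMeas (f : Ω → β) : Prop := ∀ b, MeasurableSet {ω | f ω = b}

theorem DiscMeas.const (b : β) : DiscMeas fun _ : Ω => b := fun _ => MeasurableSet.const _

theorem DiscMeas.setOf [Countable β] {f : Ω → β} (hf : DiscMeas f) (p : β → Prop) :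
    MeasurableSet {ω | p (f ω)} := by
  have : {ω | p (f ω)} = ⋃ b ∈ {b | p b}, {ω | f ω = b} := by ext ω; simp
  rw [this]
  exact MeasurableSet.biUnion (Set.to_countable _) fun b _ => hf b

theorem DiscMeas.map [Countable β] {f : Ω → β} (hf : DiscMeas f) (g : β → γ) :
    DiscMeas fun ω => g (f ω) := fun c => hf.setOf fun b => g b = c

theorem DiscMeas.prodMk {f : Ω → β} {g : Ω → γ} (hf : DiscMeas f) (hg : DiscMeas g) :
    DiscMeas fun ω => (f ω, g ω) := fun b => by
  simp only [Prod.ext_iff, Set.ofPred_and]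
  exact (hf _).inter (hg _)

theorem DiscMeas.pi {ι : Type*} [Countable ι] {β : ι → Type*} {f : Ω → ∀ i, β i}
    (hf : ∀ i, DiscMeas fun ω => f ω i) : DiscMeas f := fun b => by
  simp only [funext_iff, Set.ofPred_forall]
  exact MeasurableSet.iInter fun i => hf i _

theorem DiscMeas.comp {f : Ω → β} (hf : DiscMeas f) {g : Ω' → Ω} (hg : Measurable g) :
    DiscMeas fun ω => f (g ω) := fun b => hg (hf b)

theorem DiscMeas.app [Countable β] {f : β → Ω → γ} {g : Ω → β} (hf : ∀ b, DiscMeas (f b))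
    (hg : DiscMeas g) : DiscMeas fun ω => f (g ω) ω := fun c => by
  have : {ω | f (g ω) ω = c} = ⋃ b, {ω | g ω = b} ∩ {ω | f b ω = c} := by ext ω; simp
  rw [this]
  exact MeasurableSet.iUnion fun b => (hg b).inter (hf b c)

theorem DiscMeas.measurable [MeasurableSpace β] [Countable β] {f : Ω → β} (hf : DiscMeas f) :
    Measurable f := measurable_to_countable' fun b => hf b

end DiscMeas

/-! ### The first action in a sequence of moves -/

section FirstOf

/-- The first value in a sequence of optional values, or a default value. -/
noncomputable def firstOf {α : Type*} (m : ℕ → Option α) (a : α) : α :=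
  open Classical in
  if h : ∃ r, (m r).isSome = true then (m (Nat.find h)).get (Nat.find_spec h) else a

variable {α : Type*}

theorem firstOf_of_first {m : ℕ → Option α} {a b : α} {r : ℕ} (hr : m r = some b)
    (hlt : ∀ q < r, m q = none) : firstOf m a = b := by
  classical
  have h : ∃ r, (m r).isSome = true := ⟨r, by simp [hr]⟩
  have hf : Nat.find h = r := by
    rw [Nat.find_eq_iff]
    exact ⟨by simp [hr], fun q hq => by simp [hlt q hq]⟩
  rw [firstOf, dif_pos h]
  simp [hf, hr]

theorem firstOf_of_none {m : ℕ → Option α} {a : α} (h : ∀ r, m r = none) : firstOf m a = a := by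
  rw [firstOf, dif_neg]
  simp [h]

theorem firstOf_cases (m : ℕ → Option α) :
    (∀ r, m r = none) ∨ ∃ r b, m r = some b ∧ ∀ q < r, m q = none := by
  classical
  by_cases h : ∃ r, (m r).isSome = true
  · right
    obtain ⟨b, hb⟩ := Option.isSome_iff_exists.1 (Nat.find_spec h)
    exact ⟨_, b, hb, fun q hq => by simpa using Nat.find_min h hq⟩
  · left
    simpa using h

theorem firstOf_congr {m m' : ℕ → Option α} {a : α} {c : ℕ} (h : ∀ r < c, m r = m' r)
    (hc : ∃ r < c, (m r).isSome = true) : firstOf m a = firstOf m' a := by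
  rcases firstOf_cases m with h0 | ⟨r, b, hr, hlt⟩
  · obtain ⟨r, _, h1⟩ := hc
    simp [h0] at h1
  · have hrc : r < c := by
      obtain ⟨q, hq, h1⟩ := hc
      by_contra hrc
      rw [hlt q (by omega)] at h1
      simp at h1
    rw [firstOf_of_first hr hlt, firstOf_of_first (m := m') (r := r) (b := b)]
    · rw [← h r hrc, hr]
    · intro q hq
      rw [← h q (by omega), hlt q hq]

theorem DiscMeas.firstOf {Ω : Type*} [MeasurableSpace Ω] {m : Ω → ℕ → Option α}
    (hm : ∀ r, DiscMeas fun ω => m ω r) (a : α) : DiscMeas fun ω => firstOf (m ω) a := fun b => by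
  have : {ω | MediatorGames.firstOf (m ω) a = b} =
      ({ω | ∀ r, m ω r = none} ∩ {_ω | a = b}) ∪
        ⋃ r, ({ω | m ω r = some b} ∩ ⋂ q ∈ Set.Iio r, {ω | m ω q = none}) := by
    ext ω
    simp only [Set.mem_ofPred_eq, Set.mem_union, Set.mem_inter_iff, Set.mem_iUnion, Set.mem_iInter,
      Set.mem_Iio]
    constructor
    · intro h
      rcases firstOf_cases (m ω) with h0 | ⟨r, b', hr, hlt⟩
      · exact Or.inl ⟨h0, by rw [← h, firstOf_of_none h0]⟩
      · rw [firstOf_of_first hr hlt] at h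
        subst h
        exact Or.inr ⟨r, hr, hlt⟩
    · rintro (⟨h0, rfl⟩ | ⟨r, hr, hlt⟩)
      · exact firstOf_of_none h0
      · exact firstOf_of_first hr hlt
  rw [this]
  refine MeasurableSet.union (MeasurableSet.inter ?_ (MeasurableSet.const _)) ?_
  · rw [Set.ofPred_forall]
    exact MeasurableSet.iInter fun r => hm r _
  · refine MeasurableSet.iUnion fun r => (hm r _).inter ?_
    exact MeasurableSet.biInter (Set.to_countable _) fun q _ => hm q _

end FirstOf

/-! ### Recombining independent coins -/

section Randomness

instance : IsProbabilityMeasure coinMeasure := by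
  unfold coinMeasure; infer_instance

instance (n : ℕ) : IsProbabilityMeasure (randMeasure n) := by
  unfold randMeasure; infer_instance

variable {n : ℕ}

open Classical in
/-- The coins of the players in `D` are taken from `a`, all others from `w`. -/
noncomputable def comb (D : Finset (Fin n)) (a w : Rand n) : Rand n :=
  (fun i => if i ∈ D then a.1 i else w.1 i, w.2)

theorem comb_fst_mem {D : Finset (Fin n)} {i : Fin n} (hi : i ∈ D) (a w : Rand n) :
    (comb D a w).1 i = a.1 i := by simp [comb, hi]

theorem comb_fst_notMem {D : Finset (Fin n)} {i : Fin n} (hi : i ∉ D) (a w : Rand n) :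
    (comb D a w).1 i = w.1 i := by simp [comb, hi]

theorem comb_comb_left (D : Finset (Fin n)) (a b w : Rand n) :
    comb D (comb D a b) w = comb D a w := by
  ext i : 2
  · by_cases hi : i ∈ D <;> simp [comb, hi]
  · rfl

theorem measurePreserving_piecewise (D : Finset (Fin n)) (μ : Measure Coins)
    [IsProbabilityMeasure μ] [DecidablePred (· ∈ D)] :
    MeasurePreserving
      (fun p : (Fin n → Coins) × (Fin n → Coins) => fun i => if i ∈ D then p.1 i else p.2 i)
      ((Measure.pi fun _ => μ).prod (Measure.pi fun _ => μ)) (Measure.pi fun _ => μ) := by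
  have hm : Measurable (fun p : (Fin n → Coins) × (Fin n → Coins) =>
      fun i => if i ∈ D then p.1 i else p.2 i) := by
    refine measurable_pi_lambda _ fun i => ?_
    by_cases hi : i ∈ D
    · simp only [hi, if_true]; fun_prop
    · simp only [hi, if_false]; fun_prop
  refine ⟨hm, (Measure.pi_eq fun s hs => ?_).symm⟩
  rw [Measure.map_apply hm (MeasurableSet.univ_pi hs)]
  have : (fun p : (Fin n → Coins) × (Fin n → Coins) =>
      fun i => if i ∈ D then p.1 i else p.2 i) ⁻¹' Set.univ.pi s =
      (Set.univ.pi fun i => if i ∈ D then s i else Set.univ) ×ˢ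
        (Set.univ.pi fun i => if i ∈ D then Set.univ else s i) := by
    ext p
    simp only [Set.mem_preimage, Set.mem_pi, Set.mem_univ, true_implies, Set.mem_prod,
      ← forall_and]
    refine forall_congr' fun i => ?_
    by_cases hi : i ∈ D <;> simp [hi]
  rw [this, Measure.prod_prod, Measure.pi_pi, Measure.pi_pi, ← Finset.prod_mul_distrib]
  refine Finset.prod_congr rfl fun i _ => ?_
  by_cases hi : i ∈ D <;> simp [hi]

/-- All coins are independent, so a mixture of two independent coin vectors is again distributed
like one. This allows the coins of a coalition to be fixed or resampled separately. -/
theorem measurePreserving_comb (D : Finset (Fin n)) :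
    MeasurePreserving (fun p : Rand n × Rand n => comb D p.1 p.2)
      ((randMeasure n).prod (randMeasure n)) (randMeasure n) := by
  classical
  have h1 : MeasurePreserving (fun p : Rand n × Rand n => (p.1.1, p.2))
      ((randMeasure n).prod (randMeasure n))
      ((Measure.pi fun _ => coinMeasure).prod (randMeasure n)) :=
    MeasurePreserving.prod (f := Prod.fst) (g := id)
      (measurePreserving_fst (μ := Measure.pi fun _ : Fin n => coinMeasure) (ν := coinMeasure))
      (MeasurePreserving.id _)
  have h2 := (measurePreserving_prodAssoc (Measure.pi fun _ : Fin n => coinMeasure)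
    (Measure.pi fun _ : Fin n => coinMeasure) coinMeasure).symm
  have h3 := (measurePreserving_piecewise D coinMeasure).prod (MeasurePreserving.id coinMeasure)
  convert h3.comp (h2.comp h1) using 1
  · ext p i : 3
    · simp [comb, MeasurableEquiv.prodAssoc]
    · rfl
  · rfl

end Randomness

/-! ### Histories as functions of the sending rules -/

section Hist

variable {n : ℕ} {In Out : Type}

/-- The history of a play in which player `i` sends `S i h` after having received `h`. -/
def histOf (d : Medium n In Out) (S : Fin n → List Out → In) (c : Coins) :
    ℕ → List (Fin n → In) × (Fin n → List Out)
  | 0 => ([], fun _ => [])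
  | r + 1 =>
    let past := histOf d S c r
    let ins := past.1 ++ [fun i => S i (past.2 i)]
    (ins, fun i => past.2 i ++ [d.out ins c i])

theorem length_histOf (d : Medium n In Out) (S : Fin n → List Out → In) (c : Coins) (r : ℕ)
    (i : Fin n) : ((histOf d S c r).2 i).length = r := by
  induction r with
  | zero => rfl
  | succ r ih => simp [histOf, ih]

theorem histOf_take (d : Medium n In Out) (S : Fin n → List Out → In) (c : Coins) {m r : ℕ}
    (h : m ≤ r) (i : Fin n) : ((histOf d S c r).2 i).take m = (histOf d S c m).2 i := by
  induction r, h using Nat.le_induction with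
  | base => rw [List.take_of_length_le (length_histOf ..).le]
  | succ r hr ih =>
    have : (histOf d S c (r + 1)).2 i = (histOf d S c r).2 i ++
      [d.out (histOf d S c (r + 1)).1 c i] := rfl
    rw [this, List.take_append_of_le_length (by rw [length_histOf]; exact hr), ih]

/-- What the players receive does not change if they behave in the same way on histories of
length less than `r`. -/
theorem histOf_congr (d : Medium n In Out) {S S' : Fin n → List Out → In} (c : Coins) {r : ℕ}
    (h : ∀ i l, l.length < r → S i l = S' i l) : histOf d S c r = histOf d S' c r := by
  induction r with
  | zero => rfl
  | succ r ih =>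
    have ih' := ih fun i l hl => h i l (by omega)
    simp only [histOf, ih']
    have : (fun i => S i ((histOf d S' c r).2 i)) = fun i => S' i ((histOf d S' c r).2 i) :=
      funext fun i => h i _ (by rw [length_histOf]; omega)
    rw [this]

theorem DiscMeas.histOf [Countable In] [Countable Out] {Ω : Type*} [MeasurableSpace Ω]
    (d : Medium n In Out) {S : Ω → Fin n → List Out → In} {c : Ω → Coins}
    (hS : ∀ i l, DiscMeas fun ω => S ω i l) (hc : Measurable c) (r : ℕ) :
    DiscMeas fun ω => histOf d (S ω) (c ω) r := by
  induction r with
  | zero => exact DiscMeas.const _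
  | succ r ih =>
    have h1 : DiscMeas fun ω => fun i => S ω i ((MediatorGames.histOf d (S ω) (c ω) r).2 i) :=
      DiscMeas.pi fun i => DiscMeas.app (f := fun l ω => S ω i l) (hS i) (ih.map fun x => x.2 i)
    have h2 := (ih.prodMk h1).map fun x => x.1.1 ++ [x.2]
    have h3 : DiscMeas fun ω => fun i => d.out ((MediatorGames.histOf d (S ω) (c ω) r).1 ++
        [fun i => S ω i ((MediatorGames.histOf d (S ω) (c ω) r).2 i)]) (c ω) i :=
      DiscMeas.pi fun i => DiscMeas.app (f := fun l ω => d.out l (c ω) i)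
        (fun l => DiscMeas.comp (f := fun w => d.out l w i) (fun o => d.meas l i o) hc) h2
    exact ((ih.prodMk h2).prodMk h3).map
      fun x => (x.1.2, fun i => x.1.1.2 i ++ [x.2 i])

end Hist

namespace BayesianGame

variable {n : ℕ} {Γ : BayesianGame n} {In Out : Type}

theorem history_eq_histOf (d : Medium n In Out) (σ : Γ.Profile In Out) (t : Γ.TypeProfile)
    (w : Rand n) (r : ℕ) :
    history d σ t w r = histOf d (fun i l => (σ i).send (t i) l (w.1 i)) w.2 r := by
  induction r with
  | zero => rfl
  | succ r ih => simp only [history, histOf, ih]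

theorem outcome_eq_firstOf (d : Medium n In Out) (σ : Γ.Profile In Out) (dflt : Γ.ActProfile)
    (t : Γ.TypeProfile) (w : Rand n) (i : Fin n) :
    outcome d σ dflt t w i = firstOf (fun r => move d σ t w r i) (dflt i) := rfl

theorem length_history (d : Medium n In Out) (σ : Γ.Profile In Out) (t : Γ.TypeProfile)
    (w : Rand n) (r : ℕ) (i : Fin n) : ((history d σ t w r).2 i).length = r := by
  rw [history_eq_histOf, length_histOf]

theorem discMeas_send {i : Fin n} (s : Γ.Strategy i In Out) (t : Γ.Ty i) (l : List Out) :
    DiscMeas fun c => s.send t l c := s.meas_send t l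

theorem discMeas_act {i : Fin n} (s : Γ.Strategy i In Out) (t : Γ.Ty i) (l : List Out) :
    DiscMeas fun c => s.act t l c := s.meas_act t l

variable [Countable In] [Countable Out]

theorem discMeas_history (d : Medium n In Out) (σ : Γ.Profile In Out) (t : Γ.TypeProfile)
    (r : ℕ) : DiscMeas fun w => history d σ t w r := by
  simp only [history_eq_histOf]
  exact DiscMeas.histOf d (fun i l => (discMeas_send _ _ l).comp (by fun_prop)) (by fun_prop) r

theorem discMeas_outcome (d : Medium n In Out) (σ : Γ.Profile In Out) (dflt : Γ.ActProfile)
    (t : Γ.TypeProfile) : DiscMeas fun w => outcome d σ dflt t w := by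
  refine DiscMeas.pi fun i => DiscMeas.firstOf (m := fun w r => move d σ t w r i) (fun r => ?_) _
  have hw : Measurable fun w : Rand n => w.1 i := by fun_prop
  exact DiscMeas.app (f := fun l w => (σ i).act (t i) l (w.1 i))
    (fun l => (discMeas_act (σ i) (t i) l).comp (g := fun w : Rand n => w.1 i) hw)
    ((discMeas_history d σ t (r + 1)).map fun x => x.2 i)

theorem utility_eq_integral (d : Medium n In Out) (σ : Γ.Profile In Out) (dflt : Γ.ActProfile)
    (i : Fin n) (t : Γ.TypeProfile) :
    utility d σ dflt i t = ∫ w, Γ.u i t (outcome d σ dflt t w) ∂(randMeasure n) := by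
  classical
  let _ : MeasurableSpace Γ.ActProfile := ⊤
  have hm : Measurable fun w => outcome d σ dflt t w := (discMeas_outcome d σ dflt t).measurable
  have : IsProbabilityMeasure (Measure.map (fun w => outcome d σ dflt t w) (randMeasure n)) :=
    Measure.isProbabilityMeasure_map hm.aemeasurable
  rw [← integral_map (φ := fun w => outcome d σ dflt t w) (f := fun a => Γ.u i t a)
    hm.aemeasurable (Measurable.of_discrete).aestronglyMeasurable,
    integral_fintype (.of_finite)]
  refine Finset.sum_congr rfl fun a _ => ?_
  rw [map_measureReal_apply hm (by trivial), smul_eq_mul]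
  rfl

theorem integrable_utility (d : Medium n In Out) (σ : Γ.Profile In Out) (dflt : Γ.ActProfile)
    (i : Fin n) (t : Γ.TypeProfile) :
    Integrable (fun w => Γ.u i t (outcome d σ dflt t w)) (randMeasure n) := by
  have hm : Measurable fun w => Γ.u i t (outcome d σ dflt t w) := by
    let _ : MeasurableSpace Γ.ActProfile := ⊤
    exact (Measurable.of_discrete (f := fun a => Γ.u i t a)).comp
      (discMeas_outcome d σ dflt t).measurable
  obtain ⟨C, hC⟩ := (Set.finite_range fun a => ‖Γ.u i t a‖).bddAbove
  exact Integrable.of_bound hm.aestronglyMeasurable C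
    (Filter.Eventually.of_forall fun w => hC ⟨_, rfl⟩)

end BayesianGame

namespace BayesianGame

/-! ### Expectations conditional on the types of a set of players -/

section CondExp

variable {n : ℕ} (Γ : BayesianGame n)

/-- The expectation of a function of the type profile, conditional on the types in `S`. -/
noncomputable def condExp (S : Finset (Fin n)) (t : Γ.TypeProfile) (f : Γ.TypeProfile → ℝ) : ℝ :=
  ∑ t' ∈ Γ.agreeing S t, (Γ.prior t').toReal / Γ.typeProb S t * f t'

variable {Γ} {S : Finset (Fin n)} {t : Γ.TypeProfile} {f g : Γ.TypeProfile → ℝ}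

theorem condUtility_eq_condExp {In Out : Type} (d : Medium n In Out) (σ : Γ.Profile In Out)
    (dflt : Γ.ActProfile) (i : Fin n) :
    condUtility d σ dflt S t i = Γ.condExp S t (utility d σ dflt i) := rfl

theorem mem_agreeing {t' : Γ.TypeProfile} : t' ∈ Γ.agreeing S t ↔ ∀ i ∈ S, t' i = t i := by
  simp [agreeing]

theorem condExp_const (h : 0 < Γ.typeProb S t) (c : ℝ) : Γ.condExp S t (fun _ => c) = c := by
  rw [condExp, ← Finset.sum_mul, ← Finset.sum_div, ← typeProb, div_self h.ne', one_mul]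

theorem condExp_add : Γ.condExp S t (fun t' => f t' + g t') =
    Γ.condExp S t f + Γ.condExp S t g := by
  simp only [condExp, mul_add, Finset.sum_add_distrib]

theorem prior_toReal_pos {t' : Γ.TypeProfile} :
    0 < (Γ.prior t').toReal ↔ t' ∈ Γ.prior.support := by
  rw [ENNReal.toReal_pos_iff, PMF.mem_support_iff, pos_iff_ne_zero]
  simp [(Γ.prior.apply_ne_top t').lt_top]

theorem prior_toReal_eq_zero {t' : Γ.TypeProfile} (h : t' ∉ Γ.prior.support) :
    (Γ.prior t').toReal = 0 := by
  rw [PMF.mem_support_iff, not_not] at h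
  simp [h]

theorem sum_prior_toReal : ∑ t' : Γ.TypeProfile, (Γ.prior t').toReal = 1 := by
  classical
  have h := Γ.prior.tsum_coe
  rw [tsum_fintype] at h
  rw [← ENNReal.toReal_sum fun t' _ => Γ.prior.apply_ne_top t', h, ENNReal.toReal_one]

theorem typeProb_pos_of_mem_support (h : t ∈ Γ.prior.support) : 0 < Γ.typeProb S t :=
  Finset.sum_pos' (fun _ _ => ENNReal.toReal_nonneg)
    ⟨t, mem_agreeing.2 fun _ _ => rfl, prior_toReal_pos.2 h⟩

theorem exists_mem_support_of_typeProb_pos (h : 0 < Γ.typeProb S t) :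
    ∃ t' ∈ Γ.prior.support, ∀ i ∈ S, t' i = t i := by
  obtain ⟨t', h1, h2⟩ := Finset.exists_ne_zero_of_sum_ne_zero h.ne'
  refine ⟨t', ?_, mem_agreeing.1 h1⟩
  by_contra h3
  exact h2 (prior_toReal_eq_zero h3)

theorem condExp_mono (h : 0 < Γ.typeProb S t)
    (hfg : ∀ t' ∈ Γ.prior.support, (∀ i ∈ S, t' i = t i) → f t' ≤ g t') :
    Γ.condExp S t f ≤ Γ.condExp S t g := by
  refine Finset.sum_le_sum fun t' ht' => ?_
  by_cases hs : t' ∈ Γ.prior.support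
  · exact mul_le_mul_of_nonneg_left (hfg t' hs (mem_agreeing.1 ht'))
      (div_nonneg ENNReal.toReal_nonneg h.le)
  · simp [prior_toReal_eq_zero hs]

theorem condExp_lt (h : 0 < Γ.typeProb S t)
    (hfg : ∀ t' ∈ Γ.prior.support, (∀ i ∈ S, t' i = t i) → f t' ≤ g t')
    {t₀ : Γ.TypeProfile} (h0 : t₀ ∈ Γ.prior.support) (h0' : ∀ i ∈ S, t₀ i = t i)
    (hlt : f t₀ < g t₀) : Γ.condExp S t f < Γ.condExp S t g := by
  refine Finset.sum_lt_sum (fun t' ht' => ?_) ⟨t₀, mem_agreeing.2 h0', ?_⟩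
  · by_cases hs : t' ∈ Γ.prior.support
    · exact mul_le_mul_of_nonneg_left (hfg t' hs (mem_agreeing.1 ht'))
        (div_nonneg ENNReal.toReal_nonneg h.le)
    · simp [prior_toReal_eq_zero hs]
  · exact mul_lt_mul_of_pos_left hlt (div_pos (prior_toReal_pos.2 h0) h)

/-- Used to pair each type profile with the one in which a bit unknown to `S` is flipped. -/
theorem condExp_comp_involutive {e : Γ.TypeProfile → Γ.TypeProfile} (he : Function.Involutive e)
    (hS : ∀ t', ∀ i ∈ S, e t' i = t' i) (hp : ∀ t', Γ.prior (e t') = Γ.prior t') :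
    Γ.condExp S t (fun t' => f (e t')) = Γ.condExp S t f := by
  refine Finset.sum_nbij' e e ?_ ?_ (fun t' _ => he t') (fun t' _ => he t') ?_
  · intro t' ht'
    rw [mem_agreeing] at ht' ⊢
    exact fun i hi => (hS t' i hi).trans (ht' i hi)
  · intro t' ht'
    rw [mem_agreeing] at ht' ⊢
    exact fun i hi => (hS t' i hi).trans (ht' i hi)
  · intro t' _
    rw [hp]

/-- Law of total expectation: sum over pairs of profiles that agree on `S` and exchange the order of
summation. -/
theorem le_sum_prior_mul {S : Finset (Fin n)} {c : ℝ}
    (h : ∀ t, 0 < Γ.typeProb S t → c ≤ Γ.condExp S t f) :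
    c ≤ ∑ t, (Γ.prior t).toReal * f t := by
  classical
  have hag : ∀ t t' : Γ.TypeProfile, t' ∈ Γ.agreeing S t → Γ.typeProb S t' = Γ.typeProb S t := by
    intro t t' h'
    rw [mem_agreeing] at h'
    unfold typeProb
    congr 1
    ext x
    simp only [mem_agreeing]
    exact forall₂_congr fun i hi => by rw [h' i hi]
  calc c = ∑ t, (Γ.prior t).toReal * c := by rw [← Finset.sum_mul, sum_prior_toReal, one_mul]
    _ ≤ ∑ t, (Γ.prior t).toReal * Γ.condExp S t f := by
      refine Finset.sum_le_sum fun t _ => ?_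
      by_cases hs : t ∈ Γ.prior.support
      · exact mul_le_mul_of_nonneg_left (h t (typeProb_pos_of_mem_support hs))
          ENNReal.toReal_nonneg
      · simp [prior_toReal_eq_zero hs]
    _ = ∑ t, ∑ t', if t' ∈ Γ.agreeing S t then (Γ.prior t).toReal *
          ((Γ.prior t').toReal / Γ.typeProb S t' * f t') else 0 := by
      refine Finset.sum_congr rfl fun t _ => ?_
      rw [condExp, Finset.mul_sum, ← Finset.sum_filter]
      refine Finset.sum_congr (by ext; simp) fun t' ht' => ?_
      rw [hag t t' (Finset.mem_filter.1 ht').2]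
    _ = ∑ t', ∑ t, if t ∈ Γ.agreeing S t' then (Γ.prior t).toReal *
          ((Γ.prior t').toReal / Γ.typeProb S t' * f t') else 0 := by
      rw [Finset.sum_comm]
      refine Finset.sum_congr rfl fun t' _ => Finset.sum_congr rfl fun t _ => ?_
      have : t' ∈ Γ.agreeing S t ↔ t ∈ Γ.agreeing S t' := by
        simp only [mem_agreeing]
        exact forall₂_congr fun i hi => eq_comm
      simp only [this]
    _ = ∑ t', (Γ.prior t').toReal * f t' := by
      refine Finset.sum_congr rfl fun t' _ => ?_
      rw [← Finset.sum_filter, ← Finset.sum_mul]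
      have : Finset.univ.filter (fun t => t ∈ Γ.agreeing S t') = Γ.agreeing S t' := by ext; simp
      rw [this, ← typeProb]
      by_cases hs : t' ∈ Γ.prior.support
      · have := (typeProb_pos_of_mem_support (S := S) hs).ne'
        field_simp
      · simp [prior_toReal_eq_zero hs]

end CondExp

end BayesianGame

/-! ### Bounds for the payoff of the guessing game -/

section GuessUtility

variable {n : ℕ}

/-- The players other than `i` whose guess differs from `s`. -/
def wrongOthers (i : Fin n) (s : ZMod 2) (a : Fin n → ZMod 2 × Bool) : Finset (Fin n) :=
  Finset.univ.filter fun j => j ≠ i ∧ (a j).1 ≠ s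

/-- The players other than `i` who guess `s` and raise a flag. -/
def flagOthers (i : Fin n) (s : ZMod 2) (a : Fin n → ZMod 2 × Bool) : Finset (Fin n) :=
  Finset.univ.filter fun j => j ≠ i ∧ (a j).1 = s ∧ (a j).2 = true

/-- The payoff of player `i` if the secret is `s`: `n + 1` for guessing the secret, and a bonus of
`1` if sufficiently many other players guess wrong or raise a flag, where at most `k - 1` flags
count. -/
noncomputable def guessUtility (k m : ℕ) (i : Fin n) (s : ZMod 2)
    (a : Fin n → ZMod 2 × Bool) : ℝ :=
  (if (a i).1 = s then (n : ℝ) + 1 else 0) +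
    if k + m ≤ (wrongOthers i s a).card + min (flagOthers i s a).card (k - 1) then 1 else 0

variable {k m : ℕ} {i : Fin n} {s : ZMod 2} {a : Fin n → ZMod 2 × Bool}

theorem guessUtility_le : guessUtility k m i s a ≤ (if (a i).1 = s then (n : ℝ) + 1 else 0) + 1 := by
  unfold guessUtility
  gcongr
  split_ifs <;> norm_num

theorem le_guessUtility (h : (a i).1 = s) : (n : ℝ) + 1 ≤ guessUtility k m i s a := by
  unfold guessUtility
  rw [if_pos h]
  split_ifs <;> norm_num

/-- A fixed guess is right for at most one of two different secrets, so the total contains at most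
one main reward and two bonuses. -/
theorem guessUtility_add_le {s' : ZMod 2} (h : s ≠ s') {i : Fin n} :
    guessUtility k m i s a + guessUtility k m i s' a ≤ n + 1 + 2 := by
  have h1 := guessUtility_le (k := k) (m := m) (i := i) (s := s) (a := a)
  have h2 := guessUtility_le (k := k) (m := m) (i := i) (s := s') (a := a)
  by_cases hs : (a i).1 = s
  · rw [if_pos hs] at h1
    rw [if_neg (by rw [hs]; exact h)] at h2
    linarith
  · rw [if_neg hs] at h1
    have : (if (a i).1 = s' then (n : ℝ) + 1 else 0) ≤ n + 1 := by
      split_ifs <;> first | exact le_rfl | positivity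
    linarith

theorem guessUtility_le_of_not
    (h : ¬ k + m ≤ (wrongOthers i s a).card + min (flagOthers i s a).card (k - 1)) :
    guessUtility k m i s a ≤ n + 1 := by
  unfold guessUtility
  rw [if_neg h, add_zero]
  split_ifs
  · exact le_rfl
  · positivity

/-- Wrong and flagged others form disjoint subsets of `D` without `i`, hence number at most `k + m -
1`, one short of the bonus. -/
theorem guessUtility_le_of_coalition {D : Finset (Fin n)} (hD : D.card ≤ k + m) (hi : i ∈ D)
    (h : ∀ j ∉ D, a j = (s, false)) : guessUtility k m i s a ≤ n + 1 := by
  apply guessUtility_le_of_not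
  have hdisj : Disjoint (wrongOthers i s a) (flagOthers i s a) := by
    rw [Finset.disjoint_left]
    intro j h1 h2
    simp only [wrongOthers, flagOthers, Finset.mem_filter] at h1 h2
    exact h1.2.2 h2.2.2.1
  have hsub : wrongOthers i s a ∪ flagOthers i s a ⊆ D.erase i := by
    intro j hj
    rw [Finset.mem_erase]
    simp only [wrongOthers, flagOthers, Finset.mem_union, Finset.mem_filter, Finset.mem_univ,
      true_and] at hj
    refine ⟨by tauto, ?_⟩
    by_contra hjD
    simp [h j hjD] at hj
  have h1 := Finset.card_le_card hsub
  rw [Finset.card_union_of_disjoint hdisj, Finset.card_erase_of_mem hi] at h1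
  have := Finset.card_pos.2 ⟨i, hi⟩
  omega

/-- The cap on flags matters here: `T` supplies at most `m` wrong guesses and flags count for at
most `k - 1`, however many players raise one. -/
theorem guessUtility_le_of_right {T : Finset (Fin n)} (hk : 1 ≤ k) (hT : T.card ≤ m)
    (h : ∀ j ∉ T, (a j).1 = s) : guessUtility k m i s a ≤ n + 1 := by
  apply guessUtility_le_of_not
  have hsub : wrongOthers i s a ⊆ T := by
    intro j hj
    simp only [wrongOthers, Finset.mem_filter] at hj
    by_contra hjT
    exact hj.2.2 (h j hjT)
  have h1 := Finset.card_le_card hsub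
  omega

/-- The temptation: the members of `T` guess wrong on purpose and those of `K` raise flags, so all
coalition members except `i` count, and the fooled outsiders are added to them. -/
theorem guessUtility_eq_of_bonus {K T : Finset (Fin n)} (hKT : Disjoint K T) (hK : K.card ≤ k)
    (hi : i ∈ K) (haK : ∀ j ∈ K, a j = (s, true)) (haT : ∀ j ∈ T, (a j).1 ≠ s)
    (h : k + m ≤ (Finset.univ.filter fun j => j ∉ K ∪ T ∧ (a j).1 ≠ s).card +
      ((K ∪ T).card - 1)) : guessUtility k m i s a = n + 1 + 1 := by
  have hpos := Finset.card_pos.2 ⟨i, hi⟩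
  have h1 : T ∪ (Finset.univ.filter fun j => j ∉ K ∪ T ∧ (a j).1 ≠ s) ⊆ wrongOthers i s a := by
    intro j hj
    simp only [wrongOthers, Finset.mem_union, Finset.mem_filter, Finset.mem_univ, true_and] at hj ⊢
    rcases hj with hj | hj
    · exact ⟨fun hji => Finset.disjoint_left.1 hKT hi (hji ▸ hj), haT j hj⟩
    · exact ⟨fun hji => hj.1 (Or.inl (hji ▸ hi)), hj.2⟩
  have h2 : K.erase i ⊆ flagOthers i s a := by
    intro j hj
    rw [Finset.mem_erase] at hj
    simp [flagOthers, hj.1, haK j hj.2]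
  have h3 := Finset.card_le_card h1
  have h4 := Finset.card_le_card h2
  rw [Finset.card_union_of_disjoint] at h3
  · rw [Finset.card_erase_of_mem hi] at h4
    rw [Finset.card_union_of_disjoint hKT] at h
    unfold guessUtility
    rw [if_pos (by simp [haK i hi]), if_pos]
    omega
  · rw [Finset.disjoint_left]
    intro j hj hj'
    simp only [Finset.mem_filter, Finset.mem_union] at hj'
    tauto

end GuessUtility

/-- The Bayesian game in which the players want to guess a secret function of their types. -/
@[reducible] noncomputable def guessGame {n : ℕ} (k m : ℕ) (Ty : Fin n → Type)
    [∀ i, Fintype (Ty i)] (prior : PMF (∀ i, Ty i)) (secret : (∀ i, Ty i) → ZMod 2) :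
    BayesianGame n where
  Ty := Ty
  Act _ := ZMod 2 × Bool
  prior := prior
  u i t a := guessUtility k m i (secret t) a

/-! ### Immunity leaves few deviators without influence on the others -/

section Harmless

variable {n k m : ℕ} {Ty : Fin n → Type} [∀ i, Fintype (Ty i)] {prior : PMF (∀ i, Ty i)}
  {secret : (∀ i, Ty i) → ZMod 2} {In Out : Type} [Countable In] [Countable Out]

open BayesianGame

/-- If all outsiders of `T` guess right there is no bonus, by the cap on flags. Hence the number of
wrong outsiders bounds the bonus. -/
theorem guessUtility_le_sub_add {i : Fin n} {s : ZMod 2} {a : Fin n → ZMod 2 × Bool}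
    {T : Finset (Fin n)} (hk : 1 ≤ k) (hT : T.card ≤ m) :
    guessUtility k m i s a ≤ (n + 1) - (n + 1) * (if (a i).1 ≠ s then (1 : ℝ) else 0) +
      ∑ j ∈ Tᶜ, if (a j).1 ≠ s then (1 : ℝ) else 0 := by
  have hnn : ∀ j ∈ Tᶜ, 0 ≤ if (a j).1 ≠ s then (1 : ℝ) else 0 := fun j _ => by positivity
  by_cases h : ∀ j ∉ T, (a j).1 = s
  · by_cases hi : (a i).1 = s
    · have := guessUtility_le_of_right (i := i) hk hT h
      rw [if_neg (not_not.2 hi)]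
      have := Finset.sum_nonneg hnn
      linarith
    · have h0 : guessUtility k m i s a = 0 + 0 := by
        have h1 : ¬ k + m ≤ (wrongOthers i s a).card + min (flagOthers i s a).card (k - 1) := by
          have hsub : wrongOthers i s a ⊆ T := by
            intro j hj
            simp only [wrongOthers, Finset.mem_filter] at hj
            by_contra hjT
            exact hj.2.2 (h j hjT)
          have := Finset.card_le_card hsub
          omega
        rw [guessUtility, if_neg hi, if_neg h1]
      rw [if_pos hi]
      have := Finset.sum_nonneg hnn
      linarith
  · push Not at h
    obtain ⟨j, hj, hjs⟩ := h
    have h1 : (1 : ℝ) ≤ ∑ j ∈ Tᶜ, if (a j).1 ≠ s then (1 : ℝ) else 0 := by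
      refine le_trans ?_ (Finset.single_le_sum hnn (Finset.mem_compl.2 hj))
      rw [if_pos hjs]
    have h2 := guessUtility_le (k := k) (m := m) (i := i) (s := s) (a := a)
    by_cases hi : (a i).1 = s
    · simp only [hi, if_true, ne_eq, not_true_eq_false, if_false] at h2 ⊢
      linarith
    · simp only [hi, if_false, ne_eq, not_false_eq_true, if_true] at h2 ⊢
      linarith

/-- If a profile in a guessing game, in which everybody gets `n + 1`, is immune, then at most `m`
deviators cannot change the payoff of any other player. -/
theorem condUtility_le_of_isImmune (hk : 1 ≤ k) {d : Medium n In Out}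
    {σ : (guessGame k m Ty prior secret).Profile In Out}
    {dflt : (guessGame k m Ty prior secret).ActProfile} (himm : IsImmune d σ dflt m)
    (hσ : ∀ i t, 0 < (guessGame k m Ty prior secret).typeProb {i} t →
      (n : ℝ) + 1 ≤ condUtility d σ dflt {i} t i)
    {T : Finset (Fin n)} (hT : T.card ≤ m)
    (τ : (guessGame k m Ty prior secret).Profile (In × (Fin n → Msg)) (Out × (Fin n → Msg)))
    {i : Fin n} (hi : i ∉ T) {t : ∀ i, Ty i}
    (ht : 0 < (guessGame k m Ty prior secret).typeProb {i} t) :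
    condUtility (d.withCT T) (deviate T τ σ) dflt {i} t i ≤ n + 1 := by
  classical
  let Γ := guessGame k m Ty prior secret
  set o : (∀ i, Ty i) → Rand n → Fin n → ZMod 2 × Bool :=
    fun t w => outcome (d.withCT T) (deviate T τ σ) dflt t w with ho
  have hom : ∀ t, DiscMeas (o t) := fun t => discMeas_outcome _ _ _ _
  set p : Fin n → (∀ i, Ty i) → ℝ :=
    fun j t => (randMeasure n).real {w | (o t w j).1 ≠ secret t} with hp
  have hmeas : ∀ j t, MeasurableSet {w | (o t w j).1 ≠ secret t} := fun j t =>
    (hom t).setOf fun a => (a j).1 ≠ secret t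
  have hind : ∀ j t, ∫ w, (if (o t w j).1 ≠ secret t then (1 : ℝ) else 0) ∂(randMeasure n) =
      p j t := by
    intro j t
    refine Eq.trans ?_ (integral_indicator_one (μ := randMeasure n) (hmeas j t))
    simp only [Set.indicator_apply, Set.mem_ofPred_eq, Pi.one_apply]
  have hint : ∀ j t, Integrable (fun w => if (o t w j).1 ≠ secret t then (1 : ℝ) else 0)
      (randMeasure n) := by
    intro j t
    have := (integrable_indicator_iff (hmeas j t)).2
      (integrable_const (μ := randMeasure n) (1 : ℝ)).integrableOn
    refine this.congr (Filter.Eventually.of_forall fun w => ?_)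
    simp only [Set.indicator_apply, Set.mem_ofPred_eq]
  have hp0 : ∀ j t, 0 ≤ p j t := fun j t => measureReal_nonneg
  have hU : ∀ i t, utility (d.withCT T) (deviate T τ σ) dflt i t ≤
      (n + 1) - (n + 1) * p i t + ∑ j ∈ Tᶜ, p j t := by
    intro i t
    rw [utility_eq_integral]
    have h1 : Integrable (fun w => ((n : ℝ) + 1) - (n + 1) *
        (if (o t w i).1 ≠ secret t then (1 : ℝ) else 0)) (randMeasure n) :=
      (integrable_const _).sub ((hint i t).const_mul _)
    have h2 : Integrable (fun w => ∑ j ∈ Tᶜ, if (o t w j).1 ≠ secret t then (1 : ℝ) else 0)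
        (randMeasure n) := integrable_finsetSum _ fun j _ => hint j t
    calc _ ≤ ∫ w, (((n : ℝ) + 1) - (n + 1) * (if (o t w i).1 ≠ secret t then (1 : ℝ) else 0) +
        ∑ j ∈ Tᶜ, if (o t w j).1 ≠ secret t then (1 : ℝ) else 0) ∂(randMeasure n) := by
          refine integral_mono (integrable_utility _ _ _ _ _) (h1.add h2) fun w => ?_
          exact guessUtility_le_sub_add hk hT
      _ = _ := by
        rw [integral_add h1 h2, integral_sub (integrable_const _) ((hint i t).const_mul _),
          integral_finsetSum _ fun j _ => hint j t, integral_const_mul, hind]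
        simp only [hind]
        simp
  set P : Fin n → ℝ := fun j => ∑ t, (Γ.prior t).toReal * p j t with hP
  have hP0 : ∀ j, 0 ≤ P j := fun j =>
    Finset.sum_nonneg fun t _ => mul_nonneg ENNReal.toReal_nonneg (hp0 j t)
  -- Immunity bounds the expected payoff of `i` below by `n + 1`, and `hU` bounds it above.
  have hkey : ∀ i ∈ Tᶜ, ((n : ℝ) + 1) * P i ≤ ∑ j ∈ Tᶜ, P j := by
    intro i hi
    have h1 : (n : ℝ) + 1 ≤ ∑ t, (Γ.prior t).toReal *
        utility (d.withCT T) (deviate T τ σ) dflt i t := by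
      refine le_sum_prior_mul (S := {i}) fun t ht => ?_
      exact (hσ i t ht).trans (himm T hT τ i (Finset.mem_compl.1 hi) t ht)
    have h2 : ∑ t, (Γ.prior t).toReal * utility (d.withCT T) (deviate T τ σ) dflt i t ≤
        ∑ t, (Γ.prior t).toReal * ((n + 1) - (n + 1) * p i t + ∑ j ∈ Tᶜ, p j t) :=
      Finset.sum_le_sum fun t _ => mul_le_mul_of_nonneg_left (hU i t) ENNReal.toReal_nonneg
    have h3 : ∑ t, (Γ.prior t).toReal * ((n + 1) - (n + 1) * p i t + ∑ j ∈ Tᶜ, p j t) =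
        (n + 1) - (n + 1) * P i + ∑ j ∈ Tᶜ, P j := by
      simp only [mul_add, mul_sub, Finset.sum_add_distrib, Finset.sum_sub_distrib, hP,
        ← Finset.sum_mul, sum_prior_toReal, Finset.mul_sum, mul_one, one_mul]
      rw [Finset.sum_comm]
      congr 2
      rw [← sub_eq_zero]
      simp only [← Finset.sum_sub_distrib]
      refine Finset.sum_eq_zero fun x _ => by ring
    linarith
  -- Adding `hkey` over the at most `n` outsiders gives `(n + 1) * S ≤ n * S` for the sum `S` of
  -- their error probabilities. This is why a correct guess pays more than `n` bonuses.
  have hsum : ∑ j ∈ Tᶜ, P j = 0 := by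
    have h1 : ∑ i ∈ Tᶜ, ((n : ℝ) + 1) * P i ≤ ∑ _i ∈ Tᶜ, ∑ j ∈ Tᶜ, P j :=
      Finset.sum_le_sum hkey
    rw [← Finset.mul_sum, Finset.sum_const, nsmul_eq_mul] at h1
    have h2 : ((Tᶜ.card : ℕ) : ℝ) ≤ n := by
      exact_mod_cast (Finset.card_le_univ _).trans (by simp)
    have h3 : 0 ≤ ∑ j ∈ Tᶜ, P j := Finset.sum_nonneg fun j _ => hP0 j
    nlinarith
  have hPz : ∀ j ∈ Tᶜ, P j = 0 := (Finset.sum_eq_zero_iff_of_nonneg fun j _ => hP0 j).1 hsum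
  have hpz : ∀ j ∈ Tᶜ, ∀ t ∈ Γ.prior.support, p j t = 0 := by
    intro j hj t ht
    have := (Finset.sum_eq_zero_iff_of_nonneg
      (fun t _ => mul_nonneg ENNReal.toReal_nonneg (hp0 j t))).1 (hPz j hj) t (Finset.mem_univ _)
    exact (mul_eq_zero.1 this).resolve_left (prior_toReal_pos.2 ht).ne'
  rw [condUtility_eq_condExp, ← condExp_const ht ((n : ℝ) + 1)]
  refine condExp_mono ht fun t' ht' _ => (hU i t').trans ?_
  rw [hpz i (Finset.mem_compl.2 hi) t' ht', Finset.sum_eq_zero fun j hj => hpz j hj t' ht']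
  simp

end Harmless

/-- If distinct values of `s` lead to observations that almost surely differ, then the value of `s`
can be decoded from the observation. -/
theorem exists_decoder {ι Ω β γ : Type*} [MeasurableSpace Ω] {μ : Measure Ω} [SFinite μ]
    [Countable β] [Nonempty γ] (X : ι → Ω → β) (s : ι → γ)
    (h : ∀ i i', s i ≠ s i' → ∀ᵐ p ∂μ.prod μ, X i p.1 ≠ X i' p.2) :
    ∃ dec : β → γ, ∀ i, ∀ᵐ w ∂μ, dec (X i w) = s i := by
  classical
  -- An observation is decoded as the value at any index that produces it with positive probability.
  refine ⟨fun b => if hb : ∃ i, μ {w | X i w = b} ≠ 0 then s hb.choose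
    else Classical.arbitrary γ, fun i => ?_⟩
  have hpos : ∀ᵐ w ∂μ, μ {w' | X i w' = X i w} ≠ 0 := by
    rw [ae_iff]
    have : {w | ¬ μ {w' | X i w' = X i w} ≠ 0} ⊆
        ⋃ b ∈ {b | μ {w' | X i w' = b} = 0}, {w | X i w = b} := by
      intro w hw
      simpa using hw
    exact measure_mono_null this
      ((measure_biUnion_null_iff (Set.to_countable _)).2 fun b hb => hb)
  filter_upwards [hpos] with w hw
  have hb : ∃ i', μ {w' | X i' w' = X i w} ≠ 0 := ⟨i, hw⟩
  rw [dif_pos hb]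
  by_contra hne
  have h0 := h _ _ hne
  rw [ae_iff] at h0
  -- Two indices with different values cannot both produce the observation with positive
  -- probability: the product of these events would be a non-null part of a null set.
  have hsub : {w' | X hb.choose w' = X i w} ×ˢ {w' | X i w' = X i w} ⊆
      {p : Ω × Ω | ¬ X hb.choose p.1 ≠ X i p.2} := by
    rintro ⟨p, q⟩ ⟨h1, h2⟩
    simp only [Set.mem_ofPred_eq] at h1 h2
    simp [h1, h2]
  have := measure_mono_null hsub h0
  rw [Measure.prod_prod] at this
  rcases mul_eq_zero.1 this with h1 | h1
  · exact hb.choose_spec h1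
  · exact hw h1

/-! ### Separating the additional channels from the rest of a play -/

section WithCT

variable {n : ℕ} {Γ : BayesianGame n} {In Out : Type}

open BayesianGame

/-- The part of a play that takes place outside the additional channels. -/
theorem history_withCT (d : Medium n In Out) (D : Finset (Fin n))
    (σ : Γ.Profile (In × (Fin n → Msg)) (Out × (Fin n → Msg))) (t : Γ.TypeProfile) (w : Rand n)
    {S : Fin n → List Out → In}
    (hS : ∀ i l, ((σ i).send (t i) l (w.1 i)).1 = S i (l.map Prod.fst)) (r : ℕ) :
    (history (d.withCT D) σ t w r).1.map (fun x j => (x j).1) = (histOf d S w.2 r).1 ∧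
      ∀ i, ((history (d.withCT D) σ t w r).2 i).map Prod.fst = (histOf d S w.2 r).2 i := by
  induction r with
  | zero => exact ⟨rfl, fun _ => rfl⟩
  | succ r ih =>
    have h1 : (history (d.withCT D) σ t w (r + 1)).1.map (fun x j => (x j).1) =
        (histOf d S w.2 (r + 1)).1 := by
      simp only [history, histOf, List.map_append, ih.1, List.map_cons, List.map_nil, hS, ih.2]
    refine ⟨h1, fun i => ?_⟩
    have h2 : (history (d.withCT D) σ t w (r + 1)).2 i = (history (d.withCT D) σ t w r).2 i ++
      [(d.withCT D).out (history (d.withCT D) σ t w (r + 1)).1 w.2 i] := rfl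
    have h3 : (histOf d S w.2 (r + 1)).2 i = (histOf d S w.2 r).2 i ++
      [d.out (histOf d S w.2 (r + 1)).1 w.2 i] := rfl
    rw [h2, h3, List.map_append, ih.2, ← h1]
    rfl

/-- What is received on the additional channels. -/
theorem history_withCT_getLast (d : Medium n In Out) (D : Finset (Fin n))
    (σ : Γ.Profile (In × (Fin n → Msg)) (Out × (Fin n → Msg))) (t : Γ.TypeProfile) (w : Rand n)
    (r : ℕ) (i : Fin n) : ∃ o : Out × (Fin n → Msg),
      ((history (d.withCT D) σ t w (r + 1)).2 i).getLast? = some o ∧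
      ∀ j, o.2 j = if i ∈ D ∧ j ∈ D then
        ((σ j).send (t j) ((history (d.withCT D) σ t w r).2 j) (w.1 j)).2 i else [] := by
  refine ⟨(d.withCT D).out (history (d.withCT D) σ t w (r + 1)).1 w.2 i, ?_, fun j => ?_⟩
  · simp [history]
  · simp [history, Medium.withCT]

end WithCT

/-! ### Plays in which some players pretend to be in another situation -/

section Pretend

variable {n : ℕ} {Γ : BayesianGame n} (br : Bool) (σ : Γ.Profile (TalkIn n) (TalkOut n))

open BayesianGame

/-- The messages of a single stage of cheap talk. -/
def talk (x : Fin n → TalkIn n) (i : Fin n) : TalkOut n :=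
  fun j => ((x j).1 i, if br = true then (x j).2 else [])

theorem histOf_cheapTalk_succ (S : Fin n → List (TalkOut n) → TalkIn n) (c : Coins) (r : ℕ)
    (i : Fin n) : (histOf (cheapTalk n br) S c (r + 1)).2 i =
      (histOf (cheapTalk n br) S c r).2 i ++
        [talk br (fun j => S j ((histOf (cheapTalk n br) S c r).2 j)) i] := by
  have h : ∀ l x, (cheapTalk n br).out (l ++ [x]) c i = talk br x i := fun l x => by
    simp only [cheapTalk, List.getLast?_concat]
    rfl
  simp only [histOf, h]

open Classical in
/-- The messages sent if, after stage `r`, the players in `D` pretend that they have the types `T'`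
and the coins `b`, and have received `h'` in the first `r` stages. -/
noncomputable def pretendSend (D : Finset (Fin n)) (r : ℕ) (T' : Γ.TypeProfile)
    (h' : Fin n → List (TalkOut n)) (t : Γ.TypeProfile) (b w : Rand n) (i : Fin n)
    (l : List (TalkOut n)) : TalkIn n :=
  if i ∈ D ∧ r ≤ l.length then (σ i).send (T' i) (h' i ++ l.drop r) (b.1 i)
  else (σ i).send (t i) l (w.1 i)

/-- What has been received after `q` stages of a play with pretending players. -/
noncomputable def pretendHist (D : Finset (Fin n)) (r : ℕ) (T' : Γ.TypeProfile)
    (h' : Fin n → List (TalkOut n)) (t : Γ.TypeProfile) (b w : Rand n) (q : ℕ) :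
    Fin n → List (TalkOut n) :=
  (histOf (cheapTalk n br) (pretendSend σ D r T' h' t b w) w.2 q).2

/-- The action of a player who does not pretend. -/
noncomputable def pretendOutcome (dflt : Γ.ActProfile) (D : Finset (Fin n)) (r : ℕ)
    (T' : Γ.TypeProfile) (h' : Fin n → List (TalkOut n)) (t : Γ.TypeProfile) (b w : Rand n)
    (i : Fin n) : Γ.Act i :=
  firstOf (fun q => (σ i).act (t i) (pretendHist br σ D r T' h' t b w (q + 1) i) (w.1 i)) (dflt i)

variable {br σ} {D : Finset (Fin n)} {r : ℕ} {T' : Γ.TypeProfile}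
  {h' : Fin n → List (TalkOut n)} {t : Γ.TypeProfile} {b w : Rand n}

theorem length_pretendHist {q : ℕ} (i : Fin n) :
    (pretendHist br σ D r T' h' t b w q i).length = q := length_histOf ..

theorem pretendHist_succ (q : ℕ) (i : Fin n) : pretendHist br σ D r T' h' t b w (q + 1) i =
    pretendHist br σ D r T' h' t b w q i ++ [talk br (fun j => pretendSend σ D r T' h' t b w j
      (pretendHist br σ D r T' h' t b w q j)) i] := histOf_cheapTalk_succ ..

theorem pretendHist_take {q q' : ℕ} (h : q ≤ q') (i : Fin n) :
    (pretendHist br σ D r T' h' t b w q' i).take q = pretendHist br σ D r T' h' t b w q i :=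
  histOf_take _ _ _ h i

theorem history_take {In Out : Type} {d : Medium n In Out} {σ : Γ.Profile In Out} {q q' : ℕ}
    (h : q ≤ q') (i : Fin n) :
    ((history d σ t w q').2 i).take q = (history d σ t w q).2 i := by
  simp only [history_eq_histOf]
  exact histOf_take _ _ _ h i

theorem history_cheapTalk_succ (q : ℕ) (i : Fin n) :
    (history (cheapTalk n br) σ t w (q + 1)).2 i = (history (cheapTalk n br) σ t w q).2 i ++
      [talk br (fun j => (σ j).send (t j) ((history (cheapTalk n br) σ t w q).2 j) (w.1 j)) i] := by
  simp only [history_eq_histOf]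
  exact histOf_cheapTalk_succ ..

theorem pretendHist_eq_history {q : ℕ} (hq : q ≤ r) :
    pretendHist br σ D r T' h' t b w q = (history (cheapTalk n br) σ t w q).2 := by
  rw [history_eq_histOf, pretendHist, histOf_congr]
  intro i l hl
  rw [pretendSend, if_neg (by omega)]

/-- If the pretending players have received the same in two plays, then they would have received
the same without pretending. -/
theorem history_eq_of_pretendHist_eq {t₁ t₂ : Γ.TypeProfile} {b w₁ w₂ : Rand n}
    (ht : ∀ i ∈ D, t₁ i = t₂ i) (hw : ∀ i ∈ D, w₁.1 i = w₂.1 i)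
    (h : ∀ i ∈ D, pretendHist br σ D r T' h' t₁ b w₁ (r + 1) i =
      pretendHist br σ D r T' h' t₂ b w₂ (r + 1) i) :
    ∀ i ∈ D, (history (cheapTalk n br) σ t₁ w₁ (r + 1)).2 i =
      (history (cheapTalk n br) σ t₂ w₂ (r + 1)).2 i := by
  have hr : ∀ i ∈ D, (history (cheapTalk n br) σ t₁ w₁ r).2 i =
      (history (cheapTalk n br) σ t₂ w₂ r).2 i := by
    intro i hi
    have h1 := congrArg (List.take r) (h i hi)
    rwa [pretendHist_take (by omega), pretendHist_take (by omega), pretendHist_eq_history le_rfl,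
      pretendHist_eq_history le_rfl] at h1
  intro i hi
  have h1 := h i hi
  rw [pretendHist_succ, pretendHist_succ, pretendHist_eq_history le_rfl,
    pretendHist_eq_history le_rfl, hr i hi, List.append_cancel_left_eq, List.singleton_inj] at h1
  rw [history_cheapTalk_succ, history_cheapTalk_succ, hr i hi, List.append_cancel_left_eq,
    List.singleton_inj]
  funext j
  -- Messages from inside `D` are functions of data on which the two plays agree. Outsiders send in
  -- stage `r + 1` what they would have sent without the pretence, since it has not reached them
  -- yet.
  by_cases hj : j ∈ D
  · simp only [talk, hr j hj, ht j hj, hw j hj]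
  · have h2 := congrFun h1 j
    simpa only [talk, pretendSend, hj, false_and, if_false] using h2

theorem discMeas_pretendHist {Ω : Type*} [MeasurableSpace Ω] {b w : Ω → Rand n}
    (hb : Measurable b) (hw : Measurable w) (q : ℕ) :
    DiscMeas fun ω => pretendHist br σ D r T' h' t (b ω) (w ω) q := by
  refine (DiscMeas.histOf (cheapTalk n br) (fun i l => ?_) (by fun_prop) q).map Prod.snd
  unfold pretendSend
  split_ifs
  · exact (discMeas_send (σ i) _ _).comp (g := fun ω => (b ω).1 i) (by fun_prop)
  · exact (discMeas_send (σ i) _ _).comp (g := fun ω => (w ω).1 i) (by fun_prop)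

theorem discMeas_pretendOutcome {Ω : Type*} [MeasurableSpace Ω] {b w : Ω → Rand n}
    (hb : Measurable b) (hw : Measurable w) {dflt : Γ.ActProfile} (i : Fin n) :
    DiscMeas fun ω => pretendOutcome br σ dflt D r T' h' t (b ω) (w ω) i := by
  refine DiscMeas.firstOf (m := fun ω q => (σ i).act (t i)
    (pretendHist br σ D r T' h' t (b ω) (w ω) (q + 1) i) ((w ω).1 i)) (fun q => ?_) _
  exact DiscMeas.app (f := fun l ω => (σ i).act (t i) l ((w ω).1 i))
    (fun l => (discMeas_act (σ i) (t i) l).comp (g := fun ω => (w ω).1 i) (by fun_prop))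
    ((discMeas_pretendHist hb hw (q + 1)).map fun x => x i)

/-- Two plays in which disjoint groups of players pretend look the same for the other players, if
each group pretends to be in the situation it has in the other play. -/
theorem pretendHist_eq_pretendHist {X Y Z : Finset (Fin n)} (hcover : ∀ i, i ∈ X ∨ i ∈ Y ∨ i ∈ Z)
    (hXY : Disjoint X Y) (hXZ : Disjoint X Z) (hYZ : Disjoint Y Z)
    {t₀ t₁ : Γ.TypeProfile} {w₀ w₁ b₀ b₁ : Rand n}
    (ht : ∀ i ∈ X, t₀ i = t₁ i) (hw : ∀ i ∈ X, w₀.1 i = w₁.1 i)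
    (hb₀ : ∀ i ∈ Y, b₀.1 i = w₀.1 i) (hb₁ : ∀ i ∈ Z, b₁.1 i = w₁.1 i)
    (hX : ∀ i ∈ X, (history (cheapTalk n br) σ t₀ w₀ r).2 i =
      (history (cheapTalk n br) σ t₁ w₁ r).2 i) (q : ℕ) {i : Fin n} (hi : i ∈ X) :
    pretendHist br σ Z r t₁ (history (cheapTalk n br) σ t₁ w₁ r).2 t₀ b₁ w₀ q i =
      pretendHist br σ Y r t₀ (history (cheapTalk n br) σ t₀ w₀ r).2 t₁ b₀ w₁ q i := by
  set H₀ := (history (cheapTalk n br) σ t₀ w₀ r).2 with hH₀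
  set H₁ := (history (cheapTalk n br) σ t₁ w₁ r).2 with hH₁
  have hl₀ : ∀ i, (H₀ i).length = r := fun i => length_history ..
  have hl₁ : ∀ i, (H₁ i).length = r := fun i => length_history ..
  -- Invariant: `X` has received the same in both plays, while the real information of `Y` in the
  -- first play and of `Z` in the second is what these groups pretend to have in the other play. So
  -- all messages agree in both plays.
  have main : ∀ p, (∀ i ∈ X, pretendHist br σ Z r t₁ H₁ t₀ b₁ w₀ (r + p) i =
        pretendHist br σ Y r t₀ H₀ t₁ b₀ w₁ (r + p) i) ∧
      (∀ i ∈ Y, pretendHist br σ Z r t₁ H₁ t₀ b₁ w₀ (r + p) i =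
        H₀ i ++ (pretendHist br σ Y r t₀ H₀ t₁ b₀ w₁ (r + p) i).drop r) ∧
      (∀ i ∈ Z, H₁ i ++ (pretendHist br σ Z r t₁ H₁ t₀ b₁ w₀ (r + p) i).drop r =
        pretendHist br σ Y r t₀ H₀ t₁ b₀ w₁ (r + p) i) := by
    intro p
    induction p with
    | zero =>
      simp only [add_zero, pretendHist_eq_history le_rfl, ← hH₀, ← hH₁]
      refine ⟨hX, fun i _ => ?_, fun i _ => ?_⟩
      · rw [List.drop_eq_nil_of_le (hl₁ i).le, List.append_nil]
      · rw [List.drop_eq_nil_of_le (hl₀ i).le, List.append_nil]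
    | succ p ih =>
      obtain ⟨ihX, ihY, ihZ⟩ := ih
      have hsend : (fun j => pretendSend σ Z r t₁ H₁ t₀ b₁ w₀ j
          (pretendHist br σ Z r t₁ H₁ t₀ b₁ w₀ (r + p) j)) =
          fun j => pretendSend σ Y r t₀ H₀ t₁ b₀ w₁ j
          (pretendHist br σ Y r t₀ H₀ t₁ b₀ w₁ (r + p) j) := by
        funext j
        simp only [pretendSend, length_pretendHist, Nat.le_add_right, and_true]
        rcases hcover j with hj | hj | hj
        · rw [if_neg (Finset.disjoint_left.1 hXZ hj), if_neg (Finset.disjoint_left.1 hXY hj),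
            ihX j hj, ht j hj, hw j hj]
        · rw [if_neg (Finset.disjoint_left.1 hYZ hj), if_pos hj, ihY j hj, hb₀ j hj]
        · rw [if_pos hj, if_neg (Finset.disjoint_right.1 hYZ hj), ihZ j hj, hb₁ j hj]
      simp only [← add_assoc, pretendHist_succ, hsend]
      refine ⟨fun i hi => by rw [ihX i hi], fun i hi => ?_, fun i hi => ?_⟩
      · rw [ihY i hi, List.append_assoc, List.drop_append_of_le_length]
        rw [length_pretendHist]; omega
      · rw [List.drop_append_of_le_length (by rw [length_pretendHist]; omega), ← List.append_assoc,
          ihZ i hi]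
  have h1 := (main q).1 i hi
  have h2 := congrArg (List.take q) h1
  rwa [pretendHist_take (by omega), pretendHist_take (by omega)] at h2

end Pretend

open BayesianGame

theorem measurable_comb {n : ℕ} (D : Finset (Fin n)) :
    Measurable fun p : Rand n × Rand n => comb D p.1 p.2 := (measurePreserving_comb D).measurable

/-! ### The play resulting from a coalition of pretenders -/

section Coalition

variable {n : ℕ} {Γ : BayesianGame n} {br : Bool} (σ : Γ.Profile (TalkIn n) (TalkOut n))

/-- The deviation of a coalition whose members follow `σ` with the coins `a` for `r` stages and
then pretend to be in another situation. They tell each other what they receive, and use this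
information after stage `r + 1` to determine their actions. -/
noncomputable def coalitionStrategy (r : ℕ) (T' : Γ.TypeProfile) (h' : Fin n → List (TalkOut n))
    (a b : Rand n) (enc : List (TalkOut n) → Msg) (choice : ∀ i, (Fin n → Msg) → Γ.Act i) :
    Γ.Profile (TalkIn n × (Fin n → Msg)) (TalkOut n × (Fin n → Msg)) := fun i =>
  { send t h _ := (if r ≤ h.length then (σ i).send (T' i) (h' i ++ (h.map Prod.fst).drop r) (b.1 i)
      else (σ i).send t (h.map Prod.fst) (a.1 i), fun _ => enc (h.map Prod.fst))
    act _ h _ := if h.length = r + 2 then h.getLast?.map fun o => choice i o.2 else none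
    meas_send _ _ _ := MeasurableSet.const _
    meas_act _ _ _ := MeasurableSet.const _ }

variable {σ} {r : ℕ} {T' : Γ.TypeProfile} {h' : Fin n → List (TalkOut n)} {a b : Rand n}
  {enc : List (TalkOut n) → Msg} {choice : ∀ i, (Fin n → Msg) → Γ.Act i} {D : Finset (Fin n)}
  {t : Γ.TypeProfile} {w : Rand n} {dflt : Γ.ActProfile}

theorem history_coalition (q : ℕ) (i : Fin n) :
    ((history ((cheapTalk n br).withCT D)
      (deviate D (coalitionStrategy σ r T' h' a b enc choice) σ) t w q).2 i).map Prod.fst =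
      pretendHist br σ D r T' h' t b (comb D a w) q i := by
  refine (history_withCT (cheapTalk n br) D _ t w (S := pretendSend σ D r T' h' t b (comb D a w))
    (fun i l => ?_) q).2 i
  by_cases hi : i ∈ D
  · by_cases hl : r ≤ l.length <;> simp [deviate, coalitionStrategy, pretendSend, hi, hl, comb]
  · simp [deviate, Strategy.lift, pretendSend, hi, comb]

theorem outcome_coalition_of_notMem {j : Fin n} (hj : j ∉ D) :
    outcome ((cheapTalk n br).withCT D)
      (deviate D (coalitionStrategy σ r T' h' a b enc choice) σ) dflt t w j =
      pretendOutcome br σ dflt D r T' h' t b (comb D a w) j := by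
  rw [outcome_eq_firstOf, pretendOutcome]
  congr 1
  funext q
  rw [← history_coalition (enc := enc) (choice := choice), comb_fst_notMem hj]
  simp only [move, deviate, hj, if_false]
  rfl

theorem outcome_coalition_of_mem {i : Fin n} (hi : i ∈ D) [DecidablePred (· ∈ D)] :
    outcome ((cheapTalk n br).withCT D)
      (deviate D (coalitionStrategy σ r T' h' a b enc choice) σ) dflt t w i =
      choice i fun j => if j ∈ D then enc (pretendHist br σ D r T' h' t b (comb D a w) (r + 1) j)
        else [] := by
  rw [outcome_eq_firstOf]
  have hact : ∀ q, move ((cheapTalk n br).withCT D)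
      (deviate D (coalitionStrategy σ r T' h' a b enc choice) σ) t w q i =
      if q + 1 = r + 2 then ((history ((cheapTalk n br).withCT D)
      (deviate D (coalitionStrategy σ r T' h' a b enc choice) σ) t w (q + 1)).2 i).getLast?.map
        fun o => choice i o.2 else none := by
    intro q
    rw [move]
    conv_lhs => rw [deviate]
    rw [if_pos hi]
    simp only [coalitionStrategy, length_history]
  -- What was received up to stage `r + 1` is exchanged in stage `r + 2`, whose move has index `r +
  -- 1`.
  refine firstOf_of_first (r := r + 1) ?_ fun q hq => ?_
  · rw [hact, if_pos rfl]
    obtain ⟨o, ho, ho2⟩ := history_withCT_getLast (cheapTalk n br) D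
      (deviate D (coalitionStrategy σ r T' h' a b enc choice) σ) t w (r + 1) i
    rw [ho, Option.map_some]
    congr 2
    funext j
    rw [ho2]
    by_cases hj : j ∈ D
    · rw [if_pos ⟨hi, hj⟩, if_pos hj, ← history_coalition (enc := enc) (choice := choice)]
      conv_lhs => rw [deviate]
      simp only [if_pos hj]
      rfl
    · rw [if_neg (by tauto), if_neg hj]
  · rw [hact, if_neg (by omega)]

end Coalition

/-! ### Groups whose information does not determine the secret -/

section Ambiguous

variable {n : ℕ} {Γ : BayesianGame n} (br : Bool) (σ : Γ.Profile (TalkIn n) (TalkOut n))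
  {β : Type*} (s : Γ.TypeProfile → β)

/-- With positive probability, after `r` stages the information of the players in `X` does not
determine `s`. -/
def Ambiguous (X : Finset (Fin n)) (r : ℕ) : Prop :=
  ∃ t₀ ∈ Γ.prior.support, ∃ t₁ ∈ Γ.prior.support, (∀ i ∈ X, t₀ i = t₁ i) ∧ s t₀ ≠ s t₁ ∧
    ((randMeasure n).prod (randMeasure n)) {p | ∀ i ∈ X,
      (history (cheapTalk n br) σ t₀ p.1 r).2 i =
        (history (cheapTalk n br) σ t₁ (comb X p.1 p.2) r).2 i} ≠ 0

variable {br σ s}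

/-- By Fubini, the coins of `D` can be fixed to almost any `a` while all others stay random. The
deviation of the coalition has such coins built in. -/
theorem ae_history_ne_of_not_ambiguous {D : Finset (Fin n)} {q : ℕ}
    (h : ¬ Ambiguous br σ s D q) : ∀ᵐ a ∂(randMeasure n),
      ∀ t₀ ∈ Γ.prior.support, ∀ t₁ ∈ Γ.prior.support, (∀ i ∈ D, t₀ i = t₁ i) → s t₀ ≠ s t₁ →
      ∀ᵐ p ∂(randMeasure n).prod (randMeasure n), ¬ ∀ i ∈ D,
        (history (cheapTalk n br) σ t₀ (comb D a p.1) q).2 i =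
          (history (cheapTalk n br) σ t₁ (comb D a p.2) q).2 i := by
  rw [ae_all_iff]; intro t₀
  rw [ae_all_iff]; intro ht₀
  rw [ae_all_iff]; intro t₁
  rw [ae_all_iff]; intro ht₁
  rw [ae_all_iff]; intro hag
  rw [ae_all_iff]; intro hne
  have h0 : ∀ᵐ p ∂(randMeasure n).prod (randMeasure n), ¬ ∀ i ∈ D,
      (history (cheapTalk n br) σ t₀ p.1 q).2 i =
        (history (cheapTalk n br) σ t₁ (comb D p.1 p.2) q).2 i := by
    rw [ae_iff]
    simp only [not_not]
    by_contra h0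
    exact h ⟨t₀, ht₀, t₁, ht₁, hag, hne, h0⟩
  have hmp := ((measurePreserving_comb D).prod (MeasurePreserving.id (randMeasure n))).comp
    (measurePreserving_prodAssoc (randMeasure n) (randMeasure n) (randMeasure n)).symm
  have h1 := Measure.ae_ae_of_ae_prod (hmp.quasiMeasurePreserving.ae h0)
  filter_upwards [h1] with a ha
  filter_upwards [ha] with p hp
  simpa [MeasurableEquiv.prodAssoc, comb_comb_left] using hp

end Ambiguous

/-! ### No robust cheap-talk protocol with bounded running time -/

section Impossibility

variable {n k m : ℕ} {Ty : Fin n → Type} [∀ i, Fintype (Ty i)] {prior : PMF (∀ i, Ty i)}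
  {secret : (∀ i, Ty i) → ZMod 2} {br : Bool}
  {σ : (guessGame k m Ty prior secret).Profile (TalkIn n) (TalkOut n)}
  {dflt : (guessGame k m Ty prior secret).ActProfile}

variable (br σ dflt) in
/-- The players outside `D` who guess wrong if the players in `D` pretend. -/
noncomputable def fooled (D : Finset (Fin n)) (r : ℕ) (T' : ∀ i, Ty i)
    (h' : Fin n → List (TalkOut n)) (t : ∀ i, Ty i) (b w : Rand n) : Finset (Fin n) :=
  open Classical in
  Finset.univ.filter fun j => j ∉ D ∧
    (pretendOutcome br σ dflt D r T' h' t b w j).1 ≠ secret t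

theorem discMeas_fooled {Ω : Type*} [MeasurableSpace Ω] {b w : Ω → Rand n}
    (hb : Measurable b) (hw : Measurable w) (D : Finset (Fin n)) (r : ℕ) (T' : ∀ i, Ty i)
    (h' : Fin n → List (TalkOut n)) (t : ∀ i, Ty i) :
    DiscMeas fun ω => fooled br σ dflt D r T' h' t (b ω) (w ω) := by
  classical
  exact (DiscMeas.pi fun i => discMeas_pretendOutcome (br := br) (σ := σ) (D := D) (r := r)
    (T' := T') (h' := h') (t := t) hb hw (dflt := dflt) i).map
      fun x => Finset.univ.filter fun j => j ∉ D ∧ (x j).1 ≠ secret t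

theorem lt_integral_of_ae {Ω : Type*} [MeasurableSpace Ω] {μ : Measure Ω} [IsProbabilityMeasure μ]
    {f : Ω → ℝ} (hf : Integrable f μ) {c : ℝ} (h : ∀ᵐ w ∂μ, c ≤ f w)
    (h' : μ {w | c < f w} ≠ 0) : c < ∫ w, f w ∂μ := by
  have h1 : 0 < ∫ w, (f w - c) ∂μ := by
    rw [integral_pos_iff_support_of_nonneg_ae (h.mono fun w hw => sub_nonneg.2 hw)
      (hf.sub (integrable_const c))]
    refine (pos_iff_ne_zero.2 h').trans_le (measure_mono fun w hw => ?_)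
    exact (sub_pos.2 hw).ne'
  rw [integral_sub hf (integrable_const c)] at h1
  simpa using h1

/-- In a robust cheap-talk protocol, a coalition that will know the secret in the next stage
cannot fool the other players. -/
theorem card_fooled_lt (hk : 1 ≤ k) (hrob : IsRobust (cheapTalk n br) σ dflt k m)
    (hσ : ∀ i t, 0 < (guessGame k m Ty prior secret).typeProb {i} t →
      (n : ℝ) + 1 ≤ condUtility (cheapTalk n br) σ dflt {i} t i)
    {D : Finset (Fin n)} (hDne : D.Nonempty) (hD : D.card ≤ k + m) {r : ℕ}
    (hamb : ¬ Ambiguous br σ secret D (r + 1)) {t : ∀ i, Ty i} (ht : t ∈ prior.support) :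
    ∀ᵐ a ∂(randMeasure n), ∀ T' h' b, ∀ᵐ w ∂(randMeasure n),
      (fooled br σ dflt D r T' h' t b (comb D a w)).card + (D.card - 1) < k + m := by
  classical
  filter_upwards [ae_history_ne_of_not_ambiguous hamb] with a ha
  intro T' h' b
  obtain ⟨f, hf⟩ := Countable.exists_injective_nat (List (TalkOut n))
  let enc : List (TalkOut n) → Msg := fun l => List.replicate (f l) true
  have henc : Function.Injective enc := fun l l' h => hf (by simpa [enc] using congrArg List.length h)
  let obs : {t' // t' ∈ prior.support ∧ ∀ i ∈ D, t' i = t i} → Rand n → Fin n → Msg :=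
    fun t' w j => if j ∈ D then enc (pretendHist br σ D r T' h' t'.1 b (comb D a w) (r + 1) j)
      else []
  -- The pooled observations of the pretenders after stage `r + 1` determine the secret: equal
  -- observations would mean equal histories in the honest play.
  obtain ⟨dec, hdec⟩ := exists_decoder (μ := randMeasure n) obs (fun t' => secret t'.1) (by
    rintro ⟨t₀, ht₀, hag₀⟩ ⟨t₁, ht₁, hag₁⟩ hne
    have hag : ∀ i ∈ D, t₀ i = t₁ i := fun i hi => (hag₀ i hi).trans (hag₁ i hi).symm
    filter_upwards [ha t₀ ht₀ t₁ ht₁ hag hne] with p hp heq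
    refine hp (history_eq_of_pretendHist_eq (T' := T') (h' := h') (b := b) hag ?_ ?_)
    · intro i hi
      rw [comb_fst_mem hi, comb_fst_mem hi]
    · intro i hi
      have := congrFun heq i
      simp only [obs, if_pos hi] at this
      exact henc this)
  by_contra hnot
  -- As many members as allowed are the rational ones; at most `m` remain to serve as malicious
  -- helpers.
  obtain ⟨K, hKD, hK⟩ := Finset.exists_subset_card_eq (s := D) (n := min k D.card) (by simp)
  obtain ⟨T, rfl, hdisj⟩ : ∃ T, D = K ∪ T ∧ Disjoint K T :=
    ⟨D \ K, by rw [Finset.union_sdiff_of_subset hKD], Finset.disjoint_sdiff⟩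
  have hcard := Finset.card_union_of_disjoint hdisj
  have hKne : K.Nonempty := by
    rw [← Finset.card_pos, hK]
    have := Finset.card_pos.2 hDne
    omega
  have hKk : K.card ≤ k := by omega
  have hTm : T.card ≤ m := by omega
  let choice : Fin n → (Fin n → Msg) → ZMod 2 × Bool := fun i e =>
    if i ∈ K then (dec e, true) else (dec e + 1, false)
  let τ := coalitionStrategy (Γ := guessGame k m Ty prior secret) σ r T' h' a b enc choice
  have hsupp : t ∈ (guessGame k m Ty prior secret).prior.support := ht
  refine hrob.2 K T hKne hKk hTm hdisj t (typeProb_pos_of_mem_support hsupp) ⟨τ, fun i hi => ?_⟩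
  have hiT : i ∉ T := Finset.disjoint_left.1 hdisj hi
  -- The benchmark in `Gains` is the payoff when only `T` deviates, which is at most `n + 1`. It
  -- remains to exceed `n + 1`: all of `K` guess right, and the bonus comes with positive
  -- probability if the claim fails.
  refine lt_of_le_of_lt (condUtility_le_of_isImmune hk hrob.1 hσ hTm τ hiT
    (typeProb_pos_of_mem_support hsupp)) ?_
  have hact : ∀ t' (h' : t' ∈ prior.support ∧ ∀ i ∈ K ∪ T, t' i = t i), ∀ᵐ w ∂(randMeasure n),
      (∀ j ∈ K, outcome ((cheapTalk n br).withCT (K ∪ T)) (deviate (K ∪ T) τ σ) dflt t' w j =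
        (secret t', true)) ∧
      (∀ j ∈ T, outcome ((cheapTalk n br).withCT (K ∪ T)) (deviate (K ∪ T) τ σ) dflt t' w j =
        (secret t' + 1, false)) := by
    intro t' ht'
    filter_upwards [hdec ⟨t', ht'⟩] with w hw
    refine ⟨fun j hj => ?_, fun j hj => ?_⟩
    · refine (outcome_coalition_of_mem (Finset.mem_union_left _ hj)).trans ?_
      simp only [choice, if_pos hj]
      exact congrArg (fun x => (x, true)) hw
    · refine (outcome_coalition_of_mem (Finset.mem_union_right _ hj)).trans ?_
      simp only [choice, if_neg (Finset.disjoint_right.1 hdisj hj)]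
      exact congrArg (fun x => (x + 1, false)) hw
  have hge : ∀ t' (h' : t' ∈ prior.support ∧ ∀ i ∈ K ∪ T, t' i = t i), ∀ᵐ w ∂(randMeasure n),
      (n : ℝ) + 1 ≤ guessUtility k m i (secret t') (outcome ((cheapTalk n br).withCT (K ∪ T))
        (deviate (K ∪ T) τ σ) dflt t' w) := by
    intro t' ht'
    filter_upwards [hact t' ht'] with w hw
    exact le_guessUtility (by rw [hw.1 i hi])
  rw [condUtility_eq_condExp,
    ← condExp_const (S := K ∪ T) (typeProb_pos_of_mem_support hsupp) ((n : ℝ) + 1)]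
  refine condExp_lt (typeProb_pos_of_mem_support hsupp) (fun t' ht' hag => ?_) hsupp (fun _ _ => rfl) ?_
  · rw [utility_eq_integral]
    have := integral_mono_ae (integrable_const ((n : ℝ) + 1)) (integrable_utility _ _ _ i t')
      (hge t' ⟨ht', hag⟩)
    simpa using this
  · rw [utility_eq_integral]
    refine lt_integral_of_ae (integrable_utility (Γ := guessGame k m Ty prior secret) _ _ _ i t) ?_ ?_
    · exact hge t ⟨ht, fun _ _ => rfl⟩
    intro h0
    refine hnot ?_
    have h0' : ∀ᵐ w ∂(randMeasure n), ¬ (n : ℝ) + 1 < guessUtility k m i (secret t)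
        (outcome ((cheapTalk n br).withCT (K ∪ T)) (deviate (K ∪ T) τ σ) dflt t w) := by
      rw [ae_iff]
      simpa only [not_not] using h0
    filter_upwards [h0', hact t ⟨ht, fun _ _ => rfl⟩] with w hw hw'
    by_contra hlt
    refine hw ?_
    rw [guessUtility_eq_of_bonus (K := K) (T := T) hdisj hKk hi hw'.1
      (fun j hj => by rw [hw'.2 j hj]; simp)]
    · linarith
    · rw [not_lt] at hlt
      refine hlt.trans (Nat.add_le_add_right (Finset.card_le_card fun j hj => ?_) _)
      simp only [fooled, Finset.mem_filter, Finset.mem_univ, true_and] at hj ⊢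
      refine ⟨hj.1, ?_⟩
      rw [outcome_coalition_of_notMem hj.1]
      exact hj.2

end Impossibility

section Impossibility

variable {n k m : ℕ} {Ty : Fin n → Type} [∀ i, Fintype (Ty i)] {prior : PMF (∀ i, Ty i)}
  {secret : (∀ i, Ty i) → ZMod 2} {br : Bool}
  {σ : (guessGame k m Ty prior secret).Profile (TalkIn n) (TalkOut n)}
  {dflt : (guessGame k m Ty prior secret).ActProfile}

/-- The fixed coins become random again. There are only countably many `h'`, so one null set serves
for all of them; this matters because the pretended history will be correlated with the actual play.
-/
theorem ae_card_fooled_lt (hk : 1 ≤ k) (hrob : IsRobust (cheapTalk n br) σ dflt k m)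
    (hσ : ∀ i t, 0 < (guessGame k m Ty prior secret).typeProb {i} t →
      (n : ℝ) + 1 ≤ condUtility (cheapTalk n br) σ dflt {i} t i)
    {D : Finset (Fin n)} (hDne : D.Nonempty) (hD : D.card ≤ k + m) {r : ℕ}
    (hamb : ¬ Ambiguous br σ secret D (r + 1)) {t : ∀ i, Ty i} (ht : t ∈ prior.support)
    (T' : ∀ i, Ty i) : ∀ᵐ p ∂(randMeasure n).prod (randMeasure n), ∀ h',
      (fooled br σ dflt D r T' h' t p.1 p.2).card + (D.card - 1) < k + m := by
  rw [ae_all_iff]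
  intro h'
  rw [Measure.ae_prod_iff_ae_ae ((discMeas_fooled measurable_fst measurable_snd D r T' h' t).setOf
    fun s => s.card + (D.card - 1) < k + m)]
  refine Filter.Eventually.of_forall fun b => ?_
  have h := card_fooled_lt hk hrob hσ hDne hD hamb ht
  have hm : MeasurableSet {w | (fooled br σ dflt D r T' h' t b w).card + (D.card - 1) < k + m} :=
    (discMeas_fooled measurable_const measurable_id D r T' h' t).setOf
      fun s => s.card + (D.card - 1) < k + m
  rw [← (measurePreserving_comb D).map_eq, ae_map_iff (measurable_comb D).aemeasurable hm]
  refine (Measure.ae_prod_iff_ae_ae (measurable_comb D hm)).2 ?_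
  filter_upwards [h] with a ha
  exact ha T' h' b

theorem ambiguous_zero {X : Finset (Fin n)}
    (h : ∃ t₀ ∈ prior.support, ∃ t₁ ∈ prior.support, (∀ i ∈ X, t₀ i = t₁ i) ∧
      secret t₀ ≠ secret t₁) : Ambiguous br σ secret X 0 := by
  obtain ⟨t₀, ht₀, t₁, ht₁, hag, hne⟩ := h
  refine ⟨t₀, ht₀, t₁, ht₁, hag, hne, ?_⟩
  simp [history]

theorem exists_move_of_runningTime_le {Γ : BayesianGame n} {In Out : Type} {d : Medium n In Out}
    {σ : Γ.Profile In Out} {t : Γ.TypeProfile} {w : Rand n} {c : ℕ}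
    (h : runningTime d σ t w ≤ (c : ℕ∞)) (i : Fin n) :
    ∃ r < c, (move d σ t w r i).isSome = true := by
  by_contra hno
  push Not at hno
  have h1 : ((c + 1 : ℕ) : ℕ∞) ≤
      ⨅ (r : ℕ) (_ : (move d σ t w r i).isSome = true), ((r + 1 : ℕ) : ℕ∞) := by
    refine le_iInf₂ fun r hr => ?_
    have : c ≤ r := by
      by_contra hlt
      exact hno r (by omega) hr
    exact_mod_cast Nat.succ_le_succ this
  have h2 := (h1.trans (le_iSup (fun i : Fin n =>
    ⨅ (r : ℕ) (_ : (move d σ t w r i).isSome = true), ((r + 1 : ℕ) : ℕ∞)) i)).trans h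
  have h3 : c + 1 ≤ c := by exact_mod_cast h2
  omega

/-- A member of `X` has acted within `c` stages, so its correct guess is a function of its type, its
coins and its history of that length. -/
theorem not_ambiguous_of_runningTimeAtMost {c : ℕ}
    (hrun : RunningTimeAtMost (cheapTalk n br) σ c)
    (hright : ∀ t ∈ prior.support, ∀ᵐ w ∂(randMeasure n), ∀ i,
      (outcome (cheapTalk n br) σ dflt t w i).1 = secret t)
    {X : Finset (Fin n)} (hX : X.Nonempty) : ¬ Ambiguous br σ secret X c := by
  rintro ⟨t₀, ht₀, t₁, ht₁, hag, hne, hpos⟩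
  apply hpos
  have h0 := (Measure.quasiMeasurePreserving_fst (μ := randMeasure n)
    (ν := randMeasure n)).ae ((hright t₀ ht₀).and (hrun t₀ ht₀))
  have h1 := (measurePreserving_comb X).quasiMeasurePreserving.ae (hright t₁ ht₁)
  have h2 : ∀ᵐ p ∂(randMeasure n).prod (randMeasure n), ¬ ∀ i ∈ X,
      (history (cheapTalk n br) σ t₀ p.1 c).2 i =
        (history (cheapTalk n br) σ t₁ (comb X p.1 p.2) c).2 i := by
    filter_upwards [h0, h1] with p hp0 hp1 heq
    obtain ⟨i, hi⟩ := hX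
    refine hne ?_
    rw [← hp0.1 i, ← hp1 i, outcome_eq_firstOf, outcome_eq_firstOf]
    congr 1
    refine firstOf_congr (fun q hq => ?_) (exists_move_of_runningTime_le hp0.2 i)
    have := congrArg (List.take (q + 1)) (heq i hi)
    rw [history_take (by omega), history_take (by omega)] at this
    rw [move, move, this, hag i hi, comb_fst_mem hi]
  rw [ae_iff] at h2
  simpa only [not_not] using h2

/-- Suppose `X` cannot distinguish `t₀` from `t₁`. Let `Z` pretend `t₁` in the play with `t₀`, and
`Y` pretend `t₀` in the play with `t₁`. Since `Z` has `k + m` members, a single fooled player would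
give it the bonus, so `X` guesses the secret of `t₀`. The second play looks the same to `X`, so
there `Y` fools all of `X`, and `X.card + Y.card - 1 ≥ k + m` gives `Y` the bonus. -/
theorem not_ambiguous_of_succ (hk : 1 ≤ k) (hrob : IsRobust (cheapTalk n br) σ dflt k m)
    (hσ : ∀ i t, 0 < (guessGame k m Ty prior secret).typeProb {i} t →
      (n : ℝ) + 1 ≤ condUtility (cheapTalk n br) σ dflt {i} t i)
    (hn : 2 * k + 3 * m < n) {X Y Z : Finset (Fin n)}
    (hcover : ∀ i, i ∈ X ∨ i ∈ Y ∨ i ∈ Z)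
    (hXY : Disjoint X Y) (hXZ : Disjoint X Z) (hYZ : Disjoint Y Z)
    (hYne : Y.Nonempty) (hY : Y.card ≤ k + m) (hZ : Z.card = k + m) {r : ℕ}
    (hambY : ¬ Ambiguous br σ secret Y (r + 1)) (hambZ : ¬ Ambiguous br σ secret Z (r + 1)) :
    ¬ Ambiguous br σ secret X r := by
  rintro ⟨t₀, ht₀, t₁, ht₁, hag, hne, hpos⟩
  apply hpos
  have hZne : Z.Nonempty := by rw [← Finset.card_pos]; omega
  have hA := ae_card_fooled_lt hk hrob hσ hZne hZ.le hambZ ht₀ t₁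
  have hB := ae_card_fooled_lt hk hrob hσ hYne hY hambY ht₁ t₀
  -- The component `q.2.1` supplies the coins of `X` in both plays, `q.1` all others in the first
  -- play and `q.2.2` all others in the second. The pretenders of each play thus use coins
  -- independent of that play.
  have hMP : MeasurePreserving (fun q : Rand n × (Rand n × Rand n) => (comb X q.2.1 q.1, q.2.2))
      ((randMeasure n).prod ((randMeasure n).prod (randMeasure n)))
      ((randMeasure n).prod (randMeasure n)) :=
    (((measurePreserving_comb X).comp Measure.measurePreserving_swap).prod
      (MeasurePreserving.id (randMeasure n))).comp
      (measurePreserving_prodAssoc (randMeasure n) (randMeasure n) (randMeasure n)).symm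
  have hA' := (Measure.measurePreserving_swap.comp hMP).quasiMeasurePreserving.ae hA
  have hB' := ((MeasurePreserving.id (randMeasure n)).prod
    (measurePreserving_comb X)).quasiMeasurePreserving.ae hB
  have hm : MeasurableSet {p : Rand n × Rand n | ∀ i ∈ X,
      (history (cheapTalk n br) σ t₀ p.1 r).2 i =
        (history (cheapTalk n br) σ t₁ (comb X p.1 p.2) r).2 i} :=
    ((((discMeas_history (cheapTalk n br) σ t₀ r).comp measurable_fst).prodMk
      ((discMeas_history (cheapTalk n br) σ t₁ r).comp (measurable_comb X)))).setOf
      fun x => ∀ i ∈ X, x.1.2 i = x.2.2 i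
  rw [← hMP.measure_preimage hm.nullMeasurableSet]
  have hE : ∀ᵐ q ∂(randMeasure n).prod ((randMeasure n).prod (randMeasure n)),
      ¬ ∀ i ∈ X, (history (cheapTalk n br) σ t₀ (comb X q.2.1 q.1) r).2 i =
        (history (cheapTalk n br) σ t₁ (comb X (comb X q.2.1 q.1) q.2.2) r).2 i := by
    filter_upwards [hA', hB'] with q hqA hqB heq
    rw [comb_comb_left] at heq
    have hout : ∀ i ∈ X, pretendOutcome br σ dflt Z r t₁
          (history (cheapTalk n br) σ t₁ (comb X q.2.1 q.2.2) r).2 t₀ q.2.2 (comb X q.2.1 q.1) i =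
        pretendOutcome br σ dflt Y r t₀
          (history (cheapTalk n br) σ t₀ (comb X q.2.1 q.1) r).2 t₁ q.1 (comb X q.2.1 q.2.2) i := by
      intro i hi
      have hhist := fun q' => pretendHist_eq_pretendHist (br := br) (σ := σ) (r := r) hcover hXY hXZ
        hYZ (t₀ := t₀) (t₁ := t₁) (w₀ := comb X q.2.1 q.1) (w₁ := comb X q.2.1 q.2.2)
        (b₀ := q.1) (b₁ := q.2.2) hag
        (fun i hi => by rw [comb_fst_mem hi, comb_fst_mem hi])
        (fun i hi => by rw [comb_fst_notMem (Finset.disjoint_right.1 hXY hi)])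
        (fun i hi => by rw [comb_fst_notMem (Finset.disjoint_right.1 hXZ hi)]) heq q' hi
      simp only [pretendOutcome, hhist, hag i hi, comb_fst_mem hi]
    have h1 : (fooled br σ dflt Z r t₁ (history (cheapTalk n br) σ t₁ (comb X q.2.1 q.2.2) r).2 t₀
        q.2.2 (comb X q.2.1 q.1)).card + (Z.card - 1) < k + m := hqA _
    have h2 : (fooled br σ dflt Y r t₀ (history (cheapTalk n br) σ t₀ (comb X q.2.1 q.1) r).2 t₁
        q.1 (comb X q.2.1 q.2.2)).card + (Y.card - 1) < k + m := hqB _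
    have h3 : fooled br σ dflt Z r t₁ (history (cheapTalk n br) σ t₁ (comb X q.2.1 q.2.2) r).2 t₀
        q.2.2 (comb X q.2.1 q.1) = ∅ := by
      rw [← Finset.card_eq_zero]
      omega
    have h4 : X ⊆ fooled br σ dflt Y r t₀ (history (cheapTalk n br) σ t₀ (comb X q.2.1 q.1) r).2 t₁
        q.1 (comb X q.2.1 q.2.2) := by
      intro i hi
      simp only [fooled, Finset.mem_filter, Finset.mem_univ, true_and]
      refine ⟨Finset.disjoint_left.1 hXY hi, fun h5 => hne ?_⟩
      rw [← h5, ← hout i hi]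
      by_contra h6
      have : i ∈ fooled br σ dflt Z r t₁ (history (cheapTalk n br) σ t₁ (comb X q.2.1 q.2.2) r).2 t₀
        q.2.2 (comb X q.2.1 q.1) := by
        simp only [fooled, Finset.mem_filter, Finset.mem_univ, true_and]
        exact ⟨Finset.disjoint_left.1 hXZ hi, fun h7 => h6 h7.symm⟩
      rw [h3] at this
      simp at this
    have h5 := Finset.card_le_card h4
    have h6 : n ≤ X.card + (Y.card + Z.card) := by
      have : (Finset.univ : Finset (Fin n)) ⊆ X ∪ (Y ∪ Z) := fun i _ => by simpa using hcover i
      have := Finset.card_le_card this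
      rw [Finset.card_univ, Fintype.card_fin] at this
      exact this.trans ((Finset.card_union_le _ _).trans
        (Nat.add_le_add_left (Finset.card_union_le _ _) _))
    have := Finset.card_pos.2 hYne
    omega
  rw [ae_iff] at hE
  simp only [not_not] at hE
  exact hE

/-- If `n ≤ 3k + 3m` and no `k + m` players know anything about the secret, then there is no
robust cheap-talk protocol with bounded running time that makes all players guess the secret. -/
theorem not_isRobust_of_runningTimeAtMost (hn : 2 * k + 3 * m < n) (hn' : n ≤ 3 * k + 3 * m)
    (hsec : ∀ X : Finset (Fin n), X.card ≤ k + m → ∃ t₀ ∈ prior.support, ∃ t₁ ∈ prior.support,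
      (∀ i ∈ X, t₀ i = t₁ i) ∧ secret t₀ ≠ secret t₁)
    (hσ : ∀ i t, 0 < (guessGame k m Ty prior secret).typeProb {i} t →
      (n : ℝ) + 1 ≤ condUtility (cheapTalk n br) σ dflt {i} t i)
    (hright : ∀ t ∈ prior.support, ∀ᵐ w ∂(randMeasure n), ∀ i,
      (outcome (cheapTalk n br) σ dflt t w i).1 = secret t)
    {c : ℕ} (hrun : RunningTimeAtMost (cheapTalk n br) σ c) :
    ¬ IsRobust (cheapTalk n br) σ dflt k m := by
  intro hrob
  have hk : 1 ≤ k := by omega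
  have hsize : k + m ≤ (Finset.univ : Finset (Fin n)).card := by
    rw [Finset.card_univ, Fintype.card_fin]; omega
  obtain ⟨A, -, hA⟩ := Finset.exists_subset_card_eq hsize
  have hAc : Aᶜ.card = n - (k + m) := by rw [Finset.card_compl, hA, Fintype.card_fin]
  have hsize' : k + m ≤ Aᶜ.card := by omega
  obtain ⟨C, hCA, hC⟩ := Finset.exists_subset_card_eq hsize'
  obtain ⟨B, hB⟩ : ∃ B, B = Aᶜ \ C := ⟨_, rfl⟩
  have hBcard : B.card = n - (k + m) - (k + m) := by
    -- The bounds on `n` make this third group nonempty and at most as large as the other two.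
    rw [hB, Finset.card_sdiff_of_subset hCA, hAc, hC]
  have hAC : Disjoint A C := (disjoint_compl_right (a := A)).mono_right hCA
  have hAB : Disjoint A B := (disjoint_compl_right (a := A)).mono_right (hB ▸ Finset.sdiff_subset)
  have hBC : Disjoint B C := hB ▸ Finset.sdiff_disjoint
  have hcover : ∀ i, i ∈ A ∨ i ∈ B ∨ i ∈ C := by
    intro i
    simp only [hB, Finset.mem_sdiff, Finset.mem_compl]
    tauto
  have hAne : A.Nonempty := by rw [← Finset.card_pos]; omega
  have hBne : B.Nonempty := by rw [← Finset.card_pos]; omega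
  have hCne : C.Nonempty := by rw [← Finset.card_pos]; omega
  have hstep : ∀ q, (¬ Ambiguous br σ secret A (q + 1) ∧ ¬ Ambiguous br σ secret B (q + 1) ∧
      ¬ Ambiguous br σ secret C (q + 1)) → (¬ Ambiguous br σ secret A q ∧
      ¬ Ambiguous br σ secret B q ∧ ¬ Ambiguous br σ secret C q) := by
    rintro q ⟨h1, h2, h3⟩
    refine ⟨?_, ?_, ?_⟩
    · exact not_ambiguous_of_succ hk hrob hσ hn hcover hAB hAC hBC hBne (by omega) hC h2 h3
    · exact not_ambiguous_of_succ hk hrob hσ hn (fun i => by have := hcover i; tauto)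
        hAB.symm hBC hAC hAne hA.le hC h1 h3
    · exact not_ambiguous_of_succ hk hrob hσ hn (fun i => by have := hcover i; tauto)
        hBC.symm hAC.symm hAB.symm hBne (by omega) hA h2 h1
  have hnone : ∀ q, (¬ Ambiguous br σ secret A q ∧ ¬ Ambiguous br σ secret B q ∧
      ¬ Ambiguous br σ secret C q) → ¬ Ambiguous br σ secret A 0 := by
    intro q
    induction q with
    | zero => exact fun h => h.1
    | succ q ih => exact fun h => ih (hstep q h)
  exact hnone c ⟨not_ambiguous_of_runningTimeAtMost hrun hright hAne,
    not_ambiguous_of_runningTimeAtMost hrun hright hBne,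
    not_ambiguous_of_runningTimeAtMost hrun hright hCne⟩ (ambiguous_zero (hsec A hA.le))

end Impossibility

/-! ### The secret sharing scheme -/

section Sharing

variable {n : ℕ}

/-- A value for each set of players; the value for `A` will be known to the players outside `A`. -/
abbrev Share (n : ℕ) : Type := Finset (Fin n) → ZMod 2

/-- The part of the values that player `j` knows. -/
def share (r : Share n) (j : Fin n) : Share n := fun A => if j ∈ A then 0 else r A

/-- The shared secret is the sum of the values for the sets of size `q`. -/
def sharedSecret (q : ℕ) (r : Share n) : ZMod 2 :=
  ∑ A ∈ Finset.powersetCard q Finset.univ, r A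

open Classical in
/-- The secret, as a function of what the players know. -/
noncomputable def secretOf (q : ℕ) (t : Fin n → Share n) : ZMod 2 :=
  ∑ A ∈ Finset.powersetCard q Finset.univ, if h : ∃ j, j ∉ A then t h.choose A else 0

/-- Change the value for the set `B`. -/
def flipValue (B : Finset (Fin n)) (t : Fin n → Share n) : Fin n → Share n :=
  fun j A => t j A + if A = B ∧ j ∉ B then 1 else 0

theorem exists_notMem_of_card_lt {A : Finset (Fin n)} (h : A.card < n) : ∃ j, j ∉ A := by
  by_contra hno
  push Not at hno
  rw [Finset.eq_univ_of_forall hno, Finset.card_univ, Fintype.card_fin] at h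
  exact lt_irrefl _ h

theorem secretOf_share {q : ℕ} (hq : q < n) (r : Share n) :
    secretOf q (share r) = sharedSecret q r := by
  refine Finset.sum_congr rfl fun A hA => ?_
  have h : ∃ j, j ∉ A := exists_notMem_of_card_lt (by rwa [(Finset.mem_powersetCard.1 hA).2])
  rw [dif_pos h, share, if_neg h.choose_spec]

theorem flipValue_share (B : Finset (Fin n)) (r : Share n) :
    flipValue B (share r) = share (r + Pi.single B 1) := by
  funext j A
  by_cases hA : A = B
  · subst hA
    by_cases hj : j ∈ A <;> simp [flipValue, share, hj]
  · simp [flipValue, share, hA]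

theorem flipValue_involutive (B : Finset (Fin n)) : Function.Involutive (flipValue B) := by
  intro t
  funext j A
  by_cases h : A = B ∧ j ∉ B
  · simp [flipValue, h, add_assoc, CharTwo.add_self_eq_zero]
  · simp [flipValue, h]

theorem flipValue_apply_of_mem {B : Finset (Fin n)} {j : Fin n} (hj : j ∈ B)
    (t : Fin n → Share n) : flipValue B t j = t j := by
  funext A
  simp [flipValue, hj]

theorem sharedSecret_add_single {q : ℕ} {B : Finset (Fin n)} (hB : B.card = q) (r : Share n) :
    sharedSecret q (r + Pi.single B 1) = sharedSecret q r + 1 := by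
  classical
  simp only [sharedSecret, Pi.add_apply, Finset.sum_add_distrib]
  simp [Pi.single_apply, hB]

/-- Different secrets differ in the value of some `A` of size `q`, and that value is seen by all `n
- q` players outside `A`. -/
theorem sharedSecret_eq_of_share {q : ℕ} {r r' : Share n}
    (h : (Finset.univ.filter fun j => share r j ≠ share r' j).card < n - q) :
    sharedSecret q r = sharedSecret q r' := by
  refine Finset.sum_congr rfl fun A hA => ?_
  by_contra hne
  have hsub : Aᶜ ⊆ Finset.univ.filter fun j => share r j ≠ share r' j := by
    intro j hj
    rw [Finset.mem_compl] at hj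
    rw [Finset.mem_filter]
    refine ⟨Finset.mem_univ _, fun heq => hne ?_⟩
    simpa [share, hj] using congrFun heq A
  have := Finset.card_le_card hsub
  rw [Finset.card_compl, (Finset.mem_powersetCard.1 hA).2, Fintype.card_fin] at this
  omega

open Classical in
/-- All values are chosen independently and uniformly. -/
noncomputable def sharePrior (n : ℕ) : PMF (Fin n → Share n) :=
  PMF.uniformOfFinset (Finset.univ.image share) (Finset.univ_nonempty.image _)

theorem mem_support_sharePrior {t : Fin n → Share n} :
    t ∈ (sharePrior n).support ↔ ∃ r, share r = t := by
  simp [sharePrior, PMF.support_uniformOfFinset]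

theorem flipValue_mem_support {B : Finset (Fin n)} {t : Fin n → Share n}
    (h : t ∈ (sharePrior n).support) : flipValue B t ∈ (sharePrior n).support := by
  rw [mem_support_sharePrior] at h ⊢
  obtain ⟨r, rfl⟩ := h
  exact ⟨_, (flipValue_share B r).symm⟩

theorem sharePrior_flipValue (B : Finset (Fin n)) (t : Fin n → Share n) :
    sharePrior n (flipValue B t) = sharePrior n t := by
  classical
  have h : flipValue B t ∈ Finset.univ.image share ↔ t ∈ Finset.univ.image (share (n := n)) := by
    simp only [Finset.mem_image, Finset.mem_univ, true_and, ← mem_support_sharePrior]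
    exact ⟨fun h => by simpa [flipValue_involutive B t] using flipValue_mem_support (B := B) h,
      flipValue_mem_support⟩
  unfold sharePrior
  by_cases ht : t ∈ Finset.univ.image (share (n := n))
  · rw [PMF.uniformOfFinset_apply_of_mem _ (h.2 ht), PMF.uniformOfFinset_apply_of_mem _ ht]
  · rw [PMF.uniformOfFinset_apply_of_notMem _ (mt h.1 ht),
      PMF.uniformOfFinset_apply_of_notMem _ ht]

theorem secretOf_flipValue {q : ℕ} (hq : q < n) {B : Finset (Fin n)} (hB : B.card = q)
    {t : Fin n → Share n} (h : t ∈ (sharePrior n).support) :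
    secretOf q (flipValue B t) = secretOf q t + 1 := by
  obtain ⟨r, rfl⟩ := mem_support_sharePrior.1 h
  rw [flipValue_share, secretOf_share hq, secretOf_share hq, sharedSecret_add_single hB]

end Sharing

/-! ### Decoding the secret from partly false reports -/

section Decoding

variable {n : ℕ}

/-- An encoding of shares as messages. -/
noncomputable def shareMsg (x : Share n) : Msg :=
  List.replicate ((Countable.exists_injective_nat (Share n)).choose x) true

theorem shareMsg_injective : Function.Injective (shareMsg (n := n)) := fun x y h =>
  (Countable.exists_injective_nat (Share n)).choose_spec
    (by simpa [shareMsg] using congrArg List.length h)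

/-- The players whose message differs from their share of `r`. -/
noncomputable def mismatches (x : Fin n → Msg) (r : Share n) : Finset (Fin n) :=
  Finset.univ.filter fun j => x j ≠ shareMsg (share r j)

/-- A message that contains a secret. -/
def secretMsg (s : ZMod 2) : Msg := [decide (s = 1)]

open Classical in
/-- The message that contains the secret if at most `m` of the reports `x` are wrong; otherwise
the empty message. -/
noncomputable def decode (q m : ℕ) (x : Fin n → Msg) : Msg :=
  if h : ∃ r, (mismatches x r).card ≤ m then secretMsg (sharedSecret q h.choose) else []

theorem sharedSecret_eq_of_mismatches {q : ℕ} {x : Fin n → Msg} {r r' : Share n}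
    (h : (mismatches x r).card + (mismatches x r').card < n - q) :
    sharedSecret q r = sharedSecret q r' := by
  apply sharedSecret_eq_of_share
  refine lt_of_le_of_lt ?_ h
  refine (Finset.card_le_card fun j hj => ?_).trans (Finset.card_union_le _ _)
  simp only [mismatches, Finset.mem_union, Finset.mem_filter, Finset.mem_univ, true_and] at hj ⊢
  by_contra hno
  push Not at hno
  exact hj (shareMsg_injective (hno.1.symm.trans hno.2))

theorem decode_eq_or {q m : ℕ} {x : Fin n → Msg} {r : Share n}
    (h : (mismatches x r).card + m < n - q) :
    decode q m x = [] ∨ decode q m x = secretMsg (sharedSecret q r) := by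
  unfold decode
  split_ifs with hr
  · right
    rw [sharedSecret_eq_of_mismatches (x := x) (r := hr.choose) (r' := r)]
    have := hr.choose_spec
    omega
  · exact Or.inl rfl

theorem decode_eq_secretMsg {q m : ℕ} {x : Fin n → Msg} {r : Share n}
    (h : (mismatches x r).card ≤ m) (hm : m + m < n - q) :
    decode q m x = secretMsg (sharedSecret q r) := by
  rcases decode_eq_or (q := q) (m := m) (x := x) (r := r) (by omega) with h0 | h1
  · rw [decode, dif_pos ⟨r, h⟩] at h0
    simp [secretMsg] at h0
  · exact h1

/-- Adding the flipped value to a candidate that explains `x` gives one that explains `x'` with no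
more mismatches. So silence of the mediator carries no information about the flipped value. -/
theorem decode_eq_nil_of_flip {q m : ℕ} {x x' : Fin n → Msg} {r : Share n}
    {B : Finset (Fin n)} (hxx' : ∀ j ∈ B, x j = x' j)
    (hx : ∀ j ∉ B, x j = shareMsg (share r j))
    (hx' : ∀ j ∉ B, x' j = shareMsg (share (r + Pi.single B 1) j))
    (h : decode q m x' = []) : decode q m x = [] := by
  unfold decode at h ⊢
  rw [dif_neg]
  rintro ⟨r', hr'⟩
  rw [dif_pos] at h
  · simp [secretMsg] at h
  refine ⟨r' + Pi.single B 1, le_trans (Finset.card_le_card fun j hj => ?_) hr'⟩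
  simp only [mismatches, Finset.mem_filter, Finset.mem_univ, true_and] at hj ⊢
  rw [← flipValue_share] at hj
  by_cases hjB : j ∈ B
  · rwa [flipValue_apply_of_mem hjB, ← hxx' j hjB] at hj
  · rw [hx' j hjB, ← flipValue_share] at hj
    rw [hx j hjB]
    intro heq
    have := shareMsg_injective heq
    refine hj (congrArg shareMsg (funext fun A => ?_))
    simp only [flipValue, this]

/-- The mediator who collects the shares in the first stage and tells the secret to all players. -/
noncomputable def secretMediator (n q m : ℕ) : Mediator n where
  out h _ _ := match h.head? with
    | none => []
    | some x => decode q m x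
  meas _ _ _ := MeasurableSet.const _

/-- Guess the secret contained in a message. -/
def guessOf (o : Msg) : ZMod 2 × Bool := (if o = [true] then 1 else 0, false)

theorem guessOf_secretMsg (s : ZMod 2) : guessOf (secretMsg s) = (s, false) := by
  revert s; decide

end Decoding

/-! ### Equilibrium and punishment in the game with the mediator -/

section MediatorGame

/-- The game in which the players hold shares of a secret that they want to guess. -/
@[reducible] noncomputable def shareGame (n k m : ℕ) : BayesianGame n :=
  guessGame k m (fun _ => Share n) (sharePrior n) (secretOf (k + m))

/-- Tell the mediator one's share, and guess what the mediator says. -/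
noncomputable def reportProfile (n k m : ℕ) : (shareGame n k m).Profile Msg Msg := fun _ =>
  { send x _ _ := shareMsg x
    act _ h _ := h.head?.map guessOf
    meas_send _ _ _ := MeasurableSet.const _
    meas_act _ _ _ := MeasurableSet.const _ }

/-- Make a fixed guess. -/
noncomputable def constantProfile (n k m : ℕ) : (shareGame n k m).BaseProfile := fun _ =>
  { act _ _ := (0, false)
    meas_act _ _ := MeasurableSet.const _ }

theorem head?_history {n : ℕ} {Γ : BayesianGame n} {In Out : Type} (d : Medium n In Out)
    (σ : Γ.Profile In Out) (t : Γ.TypeProfile) (w : Rand n) (q : ℕ) :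
    (history d σ t w (q + 1)).1.head? = some fun i => (σ i).send (t i) [] (w.1 i) := by
  induction q with
  | zero => rfl
  | succ q ih =>
    have : (history d σ t w (q + 1 + 1)).1 = (history d σ t w (q + 1)).1 ++
      [fun i => (σ i).send (t i) ((history d σ t w (q + 1)).2 i) (w.1 i)] := rfl
    rw [this, List.head?_append, ih]
    rfl

/-- The deviating players notice a change of the types of the other players only if it changes the
messages of the mediator. -/
theorem history_withCT_congr {n : ℕ} {Γ : BayesianGame n} {In Out : Type} {d : Medium n In Out}
    {D : Finset (Fin n)} {σ : Γ.Profile (In × (Fin n → Msg)) (Out × (Fin n → Msg))}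
    {t t' : Γ.TypeProfile} {w : Rand n} (ht : ∀ i ∈ D, t i = t' i)
    (hd : ∀ q, ∀ i ∈ D, d.out ((history (d.withCT D) σ t w (q + 1)).1.map fun x j => (x j).1) w.2 i =
      d.out ((history (d.withCT D) σ t' w (q + 1)).1.map fun x j => (x j).1) w.2 i) (q : ℕ) :
    ∀ i ∈ D, (history (d.withCT D) σ t w q).2 i = (history (d.withCT D) σ t' w q).2 i := by
  induction q with
  | zero => exact fun _ _ => rfl
  | succ q ih =>
    intro i hi
    have h1 : ∀ t, (history (d.withCT D) σ t w (q + 1)).2 i = (history (d.withCT D) σ t w q).2 i ++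
        [(d.out ((history (d.withCT D) σ t w (q + 1)).1.map fun x j => (x j).1) w.2 i,
          fun j => if i ∈ D ∧ j ∈ D then
            ((σ j).send (t j) ((history (d.withCT D) σ t w q).2 j) (w.1 j)).2 i else [])] := by
      intro t
      simp [history, Medium.withCT]
    rw [h1, h1, ih i hi, hd q i hi]
    congr 3
    funext j
    by_cases hj : j ∈ D
    · rw [ih j hj, ht j hj]
    · simp [hj]

theorem outcome_withCT_congr {n : ℕ} {Γ : BayesianGame n} {In Out : Type} {d : Medium n In Out}
    {D : Finset (Fin n)} {σ : Γ.Profile (In × (Fin n → Msg)) (Out × (Fin n → Msg))}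
    {t t' : Γ.TypeProfile} {w : Rand n} {dflt : Γ.ActProfile} (ht : ∀ i ∈ D, t i = t' i)
    (hd : ∀ q, ∀ i ∈ D, d.out ((history (d.withCT D) σ t w (q + 1)).1.map fun x j => (x j).1) w.2 i =
      d.out ((history (d.withCT D) σ t' w (q + 1)).1.map fun x j => (x j).1) w.2 i) :
    ∀ i ∈ D, outcome (d.withCT D) σ dflt t w i = outcome (d.withCT D) σ dflt t' w i := by
  intro i hi
  rw [outcome_eq_firstOf, outcome_eq_firstOf]
  congr 1
  funext q
  rw [move, move, history_withCT_congr ht hd (q + 1) i hi, ht i hi]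

variable {n k m : ℕ} {dflt : (shareGame n k m).ActProfile}

/-- If flipping a value that the players in `S` do not know does not increase the total payoff
above `2c`, then the conditional expected payoff is at most `c`. -/
theorem condUtility_le_of_flip {In Out : Type} [Countable In] [Countable Out]
    {d : Medium n In Out} {σ : (shareGame n k m).Profile In Out} {S B : Finset (Fin n)}
    (hSB : S ⊆ B) {t : Fin n → Share n} (ht : 0 < (shareGame n k m).typeProb S t) {i : Fin n}
    {c : ℝ} (h : ∀ t' ∈ (sharePrior n).support, ∀ w,
      guessUtility k m i (secretOf (k + m) t') (outcome d σ dflt t' w) +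
      guessUtility k m i (secretOf (k + m) (flipValue B t'))
        (outcome d σ dflt (flipValue B t') w) ≤ 2 * c) :
    condUtility d σ dflt S t i ≤ c := by
  -- The flip preserves the prior and the types of `S`, so a profile and its flip contribute the
  -- same conditional expectation.
  have h1 := condExp_comp_involutive (Γ := shareGame n k m) (S := S) (t := t)
    (f := utility d σ dflt i) (flipValue_involutive B)
    (fun t' i hi => flipValue_apply_of_mem (hSB hi) t') (sharePrior_flipValue B)
  have h2 := condExp_add (Γ := shareGame n k m) (S := S) (t := t)
    (f := utility d σ dflt i) (g := fun t' => utility d σ dflt i (flipValue B t'))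
  have h3 : (shareGame n k m).condExp S t (fun t' => utility d σ dflt i t' +
      utility d σ dflt i (flipValue B t')) ≤ (shareGame n k m).condExp S t fun _ => 2 * c := by
    refine condExp_mono ht fun t' ht' _ => ?_
    rw [utility_eq_integral, utility_eq_integral,
      ← integral_add (integrable_utility d σ dflt i _) (integrable_utility d σ dflt i _)]
    have := integral_mono ((integrable_utility d σ dflt i t').add
      (integrable_utility d σ dflt i (flipValue B t')))
      (integrable_const (μ := randMeasure n) (2 * c)) (h t' ht')
    simpa using this
  rw [condExp_const ht] at h3
  rw [condUtility_eq_condExp]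
  linarith

end MediatorGame

section MediatorGame

variable {n k m : ℕ} {dflt : (shareGame n k m).ActProfile}

theorem outcome_report {t : Fin n → Share n} (w : Rand n) (i : Fin n) :
    outcome (secretMediator n (k + m) m) (reportProfile n k m) dflt t w i =
      guessOf (decode (k + m) m fun j => shareMsg (t j)) := by
  rw [outcome_eq_firstOf]
  exact firstOf_of_first (r := 0) rfl fun q hq => absurd hq (Nat.not_lt_zero q)

theorem decode_reports {t : Fin n → Share n} (ht : t ∈ (sharePrior n).support)
    (hn : 2 * k + 3 * m < n) {x : Fin n → Msg} {T : Finset (Fin n)} (hT : T.card ≤ m)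
    (hx : ∀ j ∉ T, x j = shareMsg (t j)) :
    decode (k + m) m x = secretMsg (secretOf (k + m) t) := by
  obtain ⟨r, rfl⟩ := mem_support_sharePrior.1 ht
  rw [secretOf_share (by omega)]
  refine decode_eq_secretMsg (le_trans (Finset.card_le_card fun j hj => ?_) hT) (by omega)
  by_contra hjT
  simp [mismatches, hx j hjT] at hj

theorem outcome_report_eq (hn : 2 * k + 3 * m < n) {t : Fin n → Share n}
    (ht : t ∈ (sharePrior n).support) (w : Rand n) :
    outcome (secretMediator n (k + m) m) (reportProfile n k m) dflt t w =
      fun _ => (secretOf (k + m) t, false) := by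
  funext i
  rw [outcome_report, decode_reports ht hn (T := ∅) (by simp) fun _ _ => rfl, guessOf_secretMsg]

theorem guessUtility_of_right {i : Fin n} {s : ZMod 2} (hk : 1 ≤ k) :
    guessUtility k m i s (fun _ : Fin n => (s, false)) = n + 1 :=
  le_antisymm (guessUtility_le_of_right (T := ∅) hk (by simp) fun _ _ => rfl) (le_guessUtility rfl)

theorem condUtility_report (hk : 1 ≤ k) (hn : 2 * k + 3 * m < n) {S : Finset (Fin n)}
    {t : Fin n → Share n} (ht : 0 < (shareGame n k m).typeProb S t) (i : Fin n) :
    condUtility (secretMediator n (k + m) m) (reportProfile n k m) dflt S t i = n + 1 := by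
  rw [condUtility_eq_condExp, ← condExp_const ht ((n : ℝ) + 1)]
  have h : ∀ t' ∈ (shareGame n k m).prior.support,
      utility (secretMediator n (k + m) m) (reportProfile n k m) dflt i t' = n + 1 := by
    intro t' ht'
    rw [utility_eq_integral]
    have : ∀ w, guessUtility k m i (secretOf (k + m) t')
        (outcome (secretMediator n (k + m) m) (reportProfile n k m) dflt t' w) = n + 1 := fun w => by
      rw [outcome_report_eq hn ht', guessUtility_of_right hk]
    simp [this]
  exact le_antisymm (condExp_mono ht fun t' ht' _ => (h t' ht').le)
    (condExp_mono ht fun t' ht' _ => (h t' ht').ge)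

/-- What the players report to the mediator in the first stage. -/
noncomputable def reports (D : Finset (Fin n))
    (τ : (shareGame n k m).Profile (Msg × (Fin n → Msg)) (Msg × (Fin n → Msg)))
    (t : Fin n → Share n) (w : Rand n) : Fin n → Msg :=
  fun j => ((deviate D τ (reportProfile n k m) j).send (t j) [] (w.1 j)).1

variable {D : Finset (Fin n)}
  {τ : (shareGame n k m).Profile (Msg × (Fin n → Msg)) (Msg × (Fin n → Msg))}
  {t : Fin n → Share n} {w : Rand n}

theorem reports_of_notMem {j : Fin n} (hj : j ∉ D) : reports D τ t w j = shareMsg (t j) := by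
  simp [reports, deviate, hj, Strategy.lift, reportProfile]

theorem reports_congr {t' : Fin n → Share n} {j : Fin n} (hj : t j = t' j) :
    reports D τ t w j = reports D τ t' w j := by
  simp only [reports, hj]

theorem secretMediator_out (q : ℕ) (i : Fin n) :
    (secretMediator n (k + m) m).out ((history ((secretMediator n (k + m) m).withCT D)
      (deviate D τ (reportProfile n k m)) t w (q + 1)).1.map fun x j => (x j).1) w.2 i =
      decode (k + m) m (reports D τ t w) := by
  simp only [secretMediator, List.head?_map, head?_history]
  rfl

theorem outcome_deviate_of_notMem {j : Fin n} (hj : j ∉ D) :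
    outcome ((secretMediator n (k + m) m).withCT D) (deviate D τ (reportProfile n k m)) dflt t w j =
      guessOf (decode (k + m) m (reports D τ t w)) := by
  rw [outcome_eq_firstOf]
  refine firstOf_of_first (r := 0) ?_ fun q hq => absurd hq (Nat.not_lt_zero q)
  rw [move]
  conv_lhs => rw [deviate]
  rw [if_neg hj]
  rfl

/-- The mediator is silent for `t` exactly if it is for the flipped types. If it speaks, it tells
the truth and there is no bonus in either case. If it is silent, both plays have the same actions,
one of the two guesses of `i` is wrong, and the total is at most `n + 3`. -/
theorem guessUtility_add_flip_le (hn : 2 * k + 3 * m < n) {B : Finset (Fin n)}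
    (hDB : D ⊆ B) (hB : B.card = k + m) (ht : t ∈ (sharePrior n).support) {i : Fin n} (hi : i ∈ D) :
    guessUtility k m i (secretOf (k + m) t) (outcome ((secretMediator n (k + m) m).withCT D)
        (deviate D τ (reportProfile n k m)) dflt t w) +
      guessUtility k m i (secretOf (k + m) (flipValue B t))
        (outcome ((secretMediator n (k + m) m).withCT D)
        (deviate D τ (reportProfile n k m)) dflt (flipValue B t) w) ≤ 2 * (n + 1) := by
  have hD : D.card ≤ k + m := hB ▸ Finset.card_le_card hDB
  have hag : ∀ i ∈ D, t i = flipValue B t i := fun i hi =>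
    (flipValue_apply_of_mem (hDB hi) t).symm
  have hright : ∀ t ∈ (sharePrior n).support,
      decode (k + m) m (reports D τ t w) = [] ∨ guessUtility k m i (secretOf (k + m) t)
        (outcome ((secretMediator n (k + m) m).withCT D)
        (deviate D τ (reportProfile n k m)) dflt t w) ≤ n + 1 := by
    intro t ht
    obtain ⟨r, rfl⟩ := mem_support_sharePrior.1 ht
    have hmis : (mismatches (reports D τ (share r) w) r).card ≤ D.card := by
      refine Finset.card_le_card fun j hj => ?_
      by_contra hjD
      simp [mismatches, reports_of_notMem hjD] at hj
    -- Up to `k + m` false reports plus the tolerance `m` stay below the distance `n - (k + m)`, by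
    -- `2k + 3m < n`.
    refine (decode_eq_or (q := k + m) (m := m) (x := reports D τ (share r) w) (r := r)
      (by omega)).imp_right fun h => ?_
    refine guessUtility_le_of_coalition hD hi fun j hj => ?_
    rw [outcome_deviate_of_notMem hj, h, secretOf_share (by omega), guessOf_secretMsg]
  have hnil : decode (k + m) m (reports D τ t w) = [] ↔
      decode (k + m) m (reports D τ (flipValue B t) w) = [] := by
    obtain ⟨r, rfl⟩ := mem_support_sharePrior.1 ht
    have hrep : ∀ t, ∀ j ∉ B, reports D τ t w j = shareMsg (t j) := fun t j hj =>
      reports_of_notMem fun h => hj (hDB h)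
    have hcongr : ∀ j ∈ B, reports D τ (share r) w j = reports D τ (flipValue B (share r)) w j :=
      fun j hj => reports_congr (flipValue_apply_of_mem hj _).symm
    have hss : r + Pi.single B 1 + Pi.single B 1 = r := by
      rw [add_assoc, CharTwo.add_self_eq_zero, add_zero]
    constructor
    · intro h
      refine decode_eq_nil_of_flip (r := r + Pi.single B 1) (fun j hj => (hcongr j hj).symm)
        (fun j hj => ?_) (fun j hj => ?_) h
      · rw [hrep _ j hj, flipValue_share]
      · rw [hrep _ j hj, hss]
    · intro h
      refine decode_eq_nil_of_flip (r := r) hcongr (fun j hj => hrep _ j hj) (fun j hj => ?_) h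
      rw [hrep _ j hj, flipValue_share]
  by_cases h0 : decode (k + m) m (reports D τ t w) = []
  · have hsame : outcome ((secretMediator n (k + m) m).withCT D)
        (deviate D τ (reportProfile n k m)) dflt (flipValue B t) w =
        outcome ((secretMediator n (k + m) m).withCT D)
        (deviate D τ (reportProfile n k m)) dflt t w := by
      funext j
      by_cases hj : j ∈ D
      · refine (outcome_withCT_congr hag (fun q i _ => ?_) j hj).symm
        rw [secretMediator_out, secretMediator_out, h0, hnil.1 h0]
      · rw [outcome_deviate_of_notMem hj, outcome_deviate_of_notMem hj, h0, hnil.1 h0]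
    rw [hsame, secretOf_flipValue (by omega) hB ht]
    refine (guessUtility_add_le (by simp)).trans ?_
    have : (1 : ℝ) ≤ n := by exact_mod_cast (by omega : 1 ≤ n)
    linarith
  · have h1 := (hright t ht).resolve_left h0
    have h2 := (hright _ (flipValue_mem_support (B := B) ht)).resolve_left (mt hnil.2 h0)
    linarith

theorem condUtility_report_le_of_immune (hn : 2 * k + 3 * m < n)
    (hD : D.card ≤ m) {i : Fin n} (hi : i ∉ D) {S : Finset (Fin n)}
    (ht : 0 < (shareGame n k m).typeProb S t) :
    (n : ℝ) + 1 ≤ condUtility ((secretMediator n (k + m) m).withCT D)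
      (deviate D τ (reportProfile n k m)) dflt S t i := by
  rw [condUtility_eq_condExp, ← condExp_const ht ((n : ℝ) + 1)]
  refine condExp_mono ht fun t' ht' _ => ?_
  rw [utility_eq_integral]
  have h := integral_mono (integrable_const (μ := randMeasure n) ((n : ℝ) + 1))
    (integrable_utility ((secretMediator n (k + m) m).withCT D)
      (deviate D τ (reportProfile n k m)) dflt i t') fun w => by
    refine le_guessUtility ?_
    rw [outcome_deviate_of_notMem hi, decode_reports ht' hn hD fun j hj => reports_of_notMem hj,
      guessOf_secretMsg]
  simpa using h

theorem isStrongRobust_report (hk : 1 ≤ k) (hn : 2 * k + 3 * m < n) :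
    IsStrongRobust (secretMediator n (k + m) m) (reportProfile n k m) dflt k m := by
  refine ⟨fun T hT τ i hi t ht => ?_, ?_⟩
  · rw [condUtility_report hk hn ht]
    exact condUtility_report_le_of_immune hn hT hi ht
  · rintro K T hK hT hKT t ht ⟨τ, i, hi, hgain⟩
    have hcard : (K ∪ T).card ≤ k + m := (Finset.card_union_le _ _).trans (add_le_add hK hT)
    -- The coalition is enlarged to exactly `k + m` players, because only the values of sets of that
    -- size enter the secret.
    obtain ⟨B, hDB, hB⟩ := Finset.exists_superset_card_eq hcard (by rw [Fintype.card_fin]; omega)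
    have h1 : (n : ℝ) + 1 ≤ _ := condUtility_report_le_of_immune (k := k) (m := m) (dflt := dflt)
      (τ := τ) (S := {i}) (t := t) hn hT (Finset.disjoint_left.1 hKT hi) (by
        obtain ⟨t', ht', hag⟩ := exists_mem_support_of_typeProb_pos ht
        refine Finset.sum_pos' (fun _ _ => ENNReal.toReal_nonneg)
          ⟨t', mem_agreeing.2 fun j hj => ?_, prior_toReal_pos.2 ht'⟩
        rw [Finset.mem_singleton.1 hj]
        exact hag i (Finset.mem_union_left _ hi))
    have h2 := condUtility_le_of_flip (c := (n : ℝ) + 1) (i := i) hDB ht fun t' ht' w =>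
      guessUtility_add_flip_le (dflt := dflt) (τ := τ) (w := w) hn hDB hB ht'
        (Finset.mem_union_left _ hi)
    exact absurd (lt_of_le_of_lt h1 (lt_of_lt_of_le hgain h2)) (lt_irrefl _)

theorem outcome_constant_of_notMem {K : Finset (Fin n)}
    {φ : (shareGame n k m).Profile (Unit × (Fin n → Msg)) (Unit × (Fin n → Msg))} {j : Fin n}
    (hj : j ∉ K) : outcome ((noTalk n).withCT K)
      (deviate K φ fun j => (constantProfile n k m j).toStrategy) dflt t w j = (0, false) := by
  rw [outcome_eq_firstOf]
  refine firstOf_of_first (r := 0) ?_ fun q hq => absurd hq (Nat.not_lt_zero q)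
  rw [move]
  conv_lhs => rw [deviate]
  rw [if_neg hj]
  rfl

/-- Against constant guesses the deviators learn nothing. Averaging over the flip leaves at most
half of one main reward and two bonuses, `(n + 3) / 2`, which is below `n + 1` as `n ≥ 2`. -/
theorem isPunishment_constant (hk : 1 ≤ k) (hn : 2 * k + 3 * m < n) :
    IsPunishment (secretMediator n (k + m) m) (reportProfile n k m) dflt (k + m)
      (constantProfile n k m) := by
  intro K hK φ t ht i hi
  rw [condUtility_report hk hn ht]
  obtain ⟨B, hKB, hB⟩ := Finset.exists_superset_card_eq hK (by rw [Fintype.card_fin]; omega)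
  have h := condUtility_le_of_flip (d := (noTalk n).withCT K)
    (σ := deviate K φ fun j => (constantProfile n k m j).toStrategy) (dflt := dflt)
    (c := ((n : ℝ) + 3) / 2) (i := i) hKB ht fun t' ht' w => by
      have hsame : outcome ((noTalk n).withCT K)
          (deviate K φ fun j => (constantProfile n k m j).toStrategy) dflt (flipValue B t') w =
          outcome ((noTalk n).withCT K)
          (deviate K φ fun j => (constantProfile n k m j).toStrategy) dflt t' w := by
        funext j
        by_cases hj : j ∈ K
        · refine outcome_withCT_congr (d := noTalk n) (fun i hi => ?_) (fun _ _ _ => ?_) j hj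
          · exact flipValue_apply_of_mem (hKB hi) t'
          · rfl
        · rw [outcome_constant_of_notMem hj, outcome_constant_of_notMem hj]
      rw [hsame, secretOf_flipValue (by omega) hB ht']
      refine (guessUtility_add_le (by simp)).trans ?_
      linarith
  refine lt_of_le_of_lt h ?_
  have : (2 : ℝ) ≤ n := by exact_mod_cast (by omega : 2 ≤ n)
  linarith

end MediatorGame

end MediatorGames

open MediatorGames
theorem mainTheorem1 (n k t : ℕ) (hlow : 2 * k + 3 * t < n) (hupp : n ≤ 3 * k + 3 * t) :
    ∃ (Γ : BayesianGame n) (d : Mediator n) (σ : Γ.Profile Msg Msg) (ρ : Γ.BaseProfile),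
      ∀ dflt : Γ.ActProfile,
        BayesianGame.IsStrongRobust d σ dflt k t ∧
        BayesianGame.IsPunishment d σ dflt (k + t) ρ ∧
        ∀ broadcast : Bool,
          ¬ ∃ (c : ℕ) (σ' : Γ.Profile (TalkIn n) (TalkOut n)),
            BayesianGame.RunningTimeAtMost (cheapTalk n broadcast) σ' c ∧
            BayesianGame.IsRobust (cheapTalk n broadcast) σ' dflt k t ∧
            BayesianGame.Implements d σ (cheapTalk n broadcast) σ' dflt := by
  have hk : 1 ≤ k := by omega
  refine ⟨shareGame n k t, secretMediator n (k + t) t, reportProfile n k t, constantProfile n k t,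
    fun dflt => ⟨isStrongRobust_report hk hlow, isPunishment_constant hk hlow, ?_⟩⟩
  rintro broadcast ⟨c, σ', hrun, hrob, himp⟩
  refine not_isRobust_of_runningTimeAtMost hlow hupp (fun X hX => ?_) (fun i s hs => ?_)
    (fun s hs => ?_) hrun hrob
  · obtain ⟨B, hXB, hB⟩ := Finset.exists_superset_card_eq hX (by rw [Fintype.card_fin]; omega)
    have h0 : share 0 ∈ (sharePrior n).support := mem_support_sharePrior.2 ⟨0, rfl⟩
    refine ⟨share 0, h0, flipValue B (share 0), flipValue_mem_support h0,
      fun i hi => (flipValue_apply_of_mem (hXB hi) _).symm, ?_⟩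
    rw [secretOf_flipValue (by omega) hB h0]
    simp
  · rw [← condUtility_report (dflt := dflt) hk hlow hs i]
    refine BayesianGame.condExp_mono hs fun s' hs' _ => ?_
    simp only [BayesianGame.utility, himp s' hs', le_refl]
  · have h1 : BayesianGame.actProb (secretMediator n (k + t) t) (reportProfile n k t) dflt s
        (fun _ => (secretOf (k + t) s, false)) = 1 := by
      simp [BayesianGame.actProb, outcome_report_eq hlow hs]
    rw [← himp s hs, BayesianGame.actProb] at h1
    rw [MeasureTheory.Measure.real, ENNReal.toReal_eq_one_iff, ← MeasureTheory.mem_ae_iff_prob_eq_one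
      (BayesianGame.discMeas_outcome (cheapTalk n broadcast) σ' dflt s _)] at h1
    filter_upwards [h1] with w hw i
    exact congrArg Prod.fst (congrFun hw i)
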